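/- Let $n \ge 2$, let $f(z) = z_1^2 + \cdots + z_{n+1}^2$ on $\mathbb{C}^{n+1}$, and let $K_f = \{z \in \mathbb{C}^{n+1} : f(z) = 0,\ \|z\| = 1\}$, a smooth submanifold of $\mathbb{C}^{n+1} = \mathbb{R}^{2n+2}$ of real dimension $2n-1$. Let $g(z) = z_1 + \frac{\sqrt{-1}}{2} z_2$ and $h = g|_{K_f} : K_f \to \mathbb{C} = \mathbb{R}^2$. For a smooth map $\varphi : M \to \mathbb{R}^p$ from an $m$-dimensional manifold, $m \ge p \ge 1$, let $S(\varphi)$ be the set of points at which the rank of $d\varphi$ is not $p$. A point $q \in S(\varphi)$ is a fold if, in some smooth local coordinates centred at $q$ and $\varphi(q)$, $\varphi$ has the form $(x_1, \dots, x_m) \mapsto (x_1, \dots, x_{p-1}, \pm x_p^2 \pm \cdots \pm x_m^2)$; if $\lambda$ is the number of negative signs, its absolute index is $\min\{\lambda, m-p+1-\lambda\}$. The fold is definite if its absolute index is $0$, and indefinite otherwise. $\varphi$ is a round fold map if every point of $S(\varphi)$ is a fold, every connected component of $S(\varphi)$ is diffeomorphic to the standard sphere $S^{p-1}$, and $\varphi|_{S(\varphi)}$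 is an embedding whose image is isotopic in $\mathbb{R}^p$ to a family of concentric spheres. Theorem. The map $h : K_f \to \mathbb{R}^2$ is a round fold map. Its singular set $S(h)$ is the disjoint union of two smoothly embedded circles; one consists of definite folds and the other of indefinite folds of absolute index $n-1$. Moreover $h(S(h))$ is the union of the two circles of radii $\frac{\sqrt{2}}{4}$ and $\frac{3\sqrt{2}}{4}$ centred at the origin. -/

import Mathlib

open scoped Manifold ContDiff Topology

noncomputable section

/-! ### Folds and round fold maps, for maps `φ : M → ℝᵖ` on an `m`-dimensional manifold `M` -/

section Folds

variable {m p : ℕ} {M : Type*} [TopologicalSpace M] [ChartedSpace (EuclideanSpace ℝ (Fin m)) M]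

/-- The fold normal form
`(x₁, …, xₘ) ↦ (x₁, …, xₚ₋₁, ± xₚ² ± ⋯ ± xₘ²)`, with signs given by `ε`.
(Coordinates are numbered from `0`, so `xₚ, …, xₘ` are those with `p ≤ i + 1`.) -/
def foldNormalForm (hpm : p ≤ m) (ε : Fin m → ℤˣ) (x : EuclideanSpace ℝ (Fin m)) :
    EuclideanSpace ℝ (Fin p) :=
  WithLp.toLp 2 fun j : Fin p =>
    if (j : ℕ) + 1 < p then x (Fin.castLE hpm j)
    else ∑ i ∈ Finset.univ.filter (fun i : Fin m => p ≤ (i : ℕ) + 1), (((ε i : ℤˣ) : ℤ) : ℝ) * x i ^ 2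

/-- The number `λ` of negative signs in the quadratic part of the fold normal form. -/
def negativeSigns (p : ℕ) (ε : Fin m → ℤˣ) : ℕ :=
  (Finset.univ.filter fun i : Fin m => p ≤ (i : ℕ) + 1 ∧ ε i = -1).card

variable (m)

/-- The singular point set `S(φ)`: the points where the differential of `φ` does not have
maximal rank `min m p`. -/
def singularSet (φ : M → EuclideanSpace ℝ (Fin p)) : Set M :=
  {q | Module.finrank ℝ (mfderiv (𝓡 m) (𝓡 p) φ q).range ≠ min m p}

/-- `φ` has the fold normal form with signs `ε` at `q`, in smooth local coordinates `e` around `q`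
and `e'` around `φ q` (both centred). -/
def HasFoldNormalFormAt (φ : M → EuclideanSpace ℝ (Fin p)) (q : M) (hpm : p ≤ m)
    (ε : Fin m → ℤˣ) : Prop :=
  ∃ e ∈ IsManifold.maximalAtlas (𝓡 m) ∞ M,
  ∃ e' ∈ IsManifold.maximalAtlas (𝓡 p) ∞ (EuclideanSpace ℝ (Fin p)),
    q ∈ e.source ∧ e q = 0 ∧ φ q ∈ e'.source ∧ e' (φ q) = 0 ∧
    Set.MapsTo φ e.source e'.source ∧
    ∀ x ∈ e.source, e' (φ x) = foldNormalForm hpm ε (e x)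

/-- The singular point `q` of `φ` is a fold (`1 ≤ p ≤ m`). -/
def IsFold (φ : M → EuclideanSpace ℝ (Fin p)) (q : M) : Prop :=
  q ∈ singularSet m φ ∧ 1 ≤ p ∧ ∃ (hpm : p ≤ m) (ε : Fin m → ℤˣ), HasFoldNormalFormAt m φ q hpm ε

/-- The singular point `q` of `φ` is a fold of absolute index `a = min {λ, m - p + 1 - λ}`. -/
def IsFoldOfAbsIndex (φ : M → EuclideanSpace ℝ (Fin p)) (q : M) (a : ℕ) : Prop :=
  q ∈ singularSet m φ ∧ 1 ≤ p ∧ ∃ (hpm : p ≤ m) (ε : Fin m → ℤˣ),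
    HasFoldNormalFormAt m φ q hpm ε ∧
    a = min (negativeSigns p ε) (m - p + 1 - negativeSigns p ε)

/-- A fold is definite if its absolute index is zero. -/
def IsDefiniteFold (φ : M → EuclideanSpace ℝ (Fin p)) (q : M) : Prop :=
  IsFoldOfAbsIndex m φ q 0

/-- A fold is indefinite if it is not definite. -/
def IsIndefiniteFold (φ : M → EuclideanSpace ℝ (Fin p)) (q : M) : Prop :=
  IsFold m φ q ∧ ¬ IsDefiniteFold m φ q

/-- A fold map: a smooth map that has only folds as its singularities. -/
def IsFoldMap (φ : M → EuclideanSpace ℝ (Fin p)) : Prop :=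
  ContMDiff (𝓡 m) (𝓡 p) ∞ φ ∧ ∀ q ∈ singularSet m φ, IsFold m φ q

/-- `A` is carried onto `B` by a smooth isotopy of the ambient space `ℝᵖ`. -/
def IsotopicTo (A B : Set (EuclideanSpace ℝ (Fin p))) : Prop :=
  ∃ H : ℝ → EuclideanSpace ℝ (Fin p) → EuclideanSpace ℝ (Fin p),
    ContDiff ℝ ∞ (Function.uncurry H) ∧
    (∀ t ∈ Set.Icc (0 : ℝ) 1,
      ∃ D : EuclideanSpace ℝ (Fin p) ≃ₘ^∞⟮𝓡 p, 𝓡 p⟯ EuclideanSpace ℝ (Fin p), ⇑D = H t) ∧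
    H 0 = id ∧ H 1 '' A = B

/-- A family of concentric spheres in `ℝᵖ`. -/
def IsConcentricSpheres (B : Set (EuclideanSpace ℝ (Fin p))) : Prop :=
  ∃ (c : EuclideanSpace ℝ (Fin p)) (R : Set ℝ), R ⊆ Set.Ioi 0 ∧ B = ⋃ r ∈ R, Metric.sphere c r

end Folds

section RoundFolds

variable (m : ℕ) {k : ℕ} {M : Type*} [TopologicalSpace M] [ChartedSpace (EuclideanSpace ℝ (Fin m)) M]

/-- `ι` is a smooth embedding of the standard sphere `Sᵏ` in `M` with image `C`, so that `C` is a
submanifold of `M` diffeomorphic to `Sᵏ` by `ι`. -/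
def ParametrizesSphere (ι : Metric.sphere (0 : EuclideanSpace ℝ (Fin (k + 1))) 1 → M)
    (C : Set M) : Prop :=
  Manifold.IsSmoothEmbedding (𝓡 k) (𝓡 m) ∞ ι ∧ Set.range ι = C

/-- A round fold map `φ : M → ℝᵏ⁺¹`: a fold map such that each connected component of `S(φ)` is
diffeomorphic to `Sᵏ`, and `φ` restricted to `S(φ)` is an embedding (a topological embedding, and
an immersion on each component) whose image is isotopic to a family of concentric spheres. -/
def IsRoundFoldMap (φ : M → EuclideanSpace ℝ (Fin (k + 1))) : Prop :=
  IsFoldMap m φ ∧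
  (∀ q ∈ singularSet m φ, ∃ ι : Metric.sphere (0 : EuclideanSpace ℝ (Fin (k + 1))) 1 → M,
    ParametrizesSphere m ι (connectedComponentIn (singularSet m φ) q) ∧
    Manifold.IsImmersion (𝓡 k) (𝓡 (k + 1)) ∞ (φ ∘ ι)) ∧
  Topology.IsEmbedding ((singularSet m φ).domRestrict φ) ∧
  ∃ B, IsConcentricSpheres B ∧ IsotopicTo (φ '' singularSet m φ) B

/-- `C` is a smoothly embedded circle in `M`. -/
def IsSmoothCircle (C : Set M) : Prop :=
  ∃ ι : Metric.sphere (0 : EuclideanSpace ℝ (Fin (1 + 1))) 1 → M, ParametrizesSphere m ι C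

end RoundFolds

/-! ### The link and the map -/

/-- `f(z) = z₁² + ⋯ + zₙ₊₁²`. -/
def sumSquares (n : ℕ) (z : EuclideanSpace ℂ (Fin (n + 1))) : ℂ := ∑ j, z j ^ 2

/-- The link `K_f = {z ∈ ℂⁿ⁺¹ | f(z) = 0, ‖z‖ = 1}`, with the subspace topology. -/
def link (n : ℕ) : Set (EuclideanSpace ℂ (Fin (n + 1))) := {z | sumSquares n z = 0 ∧ ‖z‖ = 1}

/-- `g(z) = z₁ + (√-1 / 2) z₂` (coordinates are numbered from `0`). -/
def linearForm (n : ℕ) (z : EuclideanSpace ℂ (Fin (n + 1))) : ℂ := z 0 + Complex.I / 2 * z 1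

/-- `h = g|_{K_f} : K_f → ℂ = ℝ²`. -/
def linkMap (n : ℕ) (z : link n) : EuclideanSpace ℝ (Fin 2) :=
  !₂[(linearForm n z).re, (linearForm n z).im]

/-- A given atlas of dimension `2n - 1` makes `K_f` a smooth submanifold of `ℂⁿ⁺¹ = ℝ²ⁿ⁺²`. -/
def IsSubmanifoldAtlas (n : ℕ) (cs : ChartedSpace (EuclideanSpace ℝ (Fin (2 * n - 1))) (link n)) :
    Prop :=
  IsManifold (𝓡 (2 * n - 1)) ∞ (link n) ∧
  Manifold.IsSmoothEmbedding (𝓡 (2 * n - 1)) 𝓘(ℝ, EuclideanSpace ℂ (Fin (n + 1))) ∞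
    (Subtype.val : link n → EuclideanSpace ℂ (Fin (n + 1)))

end

/-! For δ = ±1 put P = z₁ - δi z₂ and Q = z₁ + δi z₂, and let w be the remaining coordinates. Then f
= PQ + Σ wⱼ², g = ((2+δ)Q + (2-δ)P)/4, and on the link |P|² + |Q|² + 2Σ|wⱼ|² = 2.

Singular set: at a point q of the link, q and its conjugate are Hermitian orthonormal, and the
complex subspace orthogonal to both is tangent to the link. If w ≠ 0, projecting the vector dual to
g to this subspace gives a tangent v with g(v) > 0, whose complex multiples show that dh is onto
(`exists_tangent_linearForm_eq`). If w = 0 then PQ = 0, so q lies on one of the circles Q = w = 0,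
one for each δ; there dh misses the radial direction (`linearForm_ne_of_tangent`). On such a circle
h is a homothety onto the circle of radius (2-δ)√2/4, which gives the embedding and the critical
values.

Folds: one coordinate follows the angle of g, and |g|² has to be diagonalized in the others. This is
done explicitly. With uⱼ = wⱼP̄, the difference of |g|² and its critical value is a quadratic form
in Re u and Im u with variable coefficients, up to one quartic term
(`foldRadius_mul_normSq_linearForm`); extracting square roots and absorbing that term gives
`morseCoord`. There are n - 1 negative squares and n - 1 squares of sign δ: all negative for δ = -1,
balanced for δ = 1. To exclude that a balanced point is definite in other coordinates, a topological
invariant is used: a map to the plane is not locally onto at a definite fold, but is so when both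
signs occur.

The submanifold structure is arbitrary: charts cut out by ambient maps lie in its maximal atlas
because the inclusion is an immersion (`IsSubmanifoldChart.mem_maximalAtlas`). -/

/-! ### Inverse function theorem -/

section InverseFunction

/-- Inverse function theorem: a smooth map between spaces of the same finite dimension whose
derivative at a point is injective is a local diffeomorphism there. -/
theorem exists_openPartialHomeomorph_of_injective_fderiv {E F : Type*} [NormedAddCommGroup E]
    [NormedSpace ℝ E] [FiniteDimensional ℝ E] [NormedAddCommGroup F] [NormedSpace ℝ F]
    [FiniteDimensional ℝ F] (hdim : Module.finrank ℝ E = Module.finrank ℝ F) {f : E → F} {U : Set E}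
    (hU : IsOpen U) (hf : ContDiffOn ℝ ∞ f U) {a : E} (ha : a ∈ U)
    (hinj : ∀ v, fderiv ℝ f a v = 0 → v = 0) :
    ∃ Φ : OpenPartialHomeomorph E F, a ∈ Φ.source ∧ Φ.source ⊆ U ∧ ⇑Φ = f ∧
      ContDiffOn ℝ ∞ Φ.symm Φ.target := by
  have : CompleteSpace E := FiniteDimensional.complete ℝ E
  have hfa : ContDiffAt ℝ ∞ f a := hf.contDiffAt (hU.mem_nhds ha)
  let A : E ≃L[ℝ] F := (LinearEquiv.ofInjectiveOfFinrankEq (fderiv ℝ f a : E →ₗ[ℝ] F)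
    ((injective_iff_map_eq_zero _).2 hinj) hdim).toContinuousLinearEquiv
  have hA : (A : E →L[ℝ] F) = fderiv ℝ f a := by ext v; rfl
  have hder : HasFDerivAt f (A : E →L[ℝ] F) a := by
    rw [hA]; exact (hfa.differentiableAt (by simp)).hasFDerivAt
  have hcont : ContinuousOn (fderiv ℝ f) U :=
    hf.continuousOn_fderiv_of_isOpen hU (by simp)
  -- Invertible operators form an open set. Shrinking to the points with invertible derivative makes
  -- the inverse smooth on the whole target, not only at the image of `a`.
  have hV : IsOpen (U ∩ fderiv ℝ f ⁻¹' Set.range ((↑) : (E ≃L[ℝ] F) → E →L[ℝ] F)) :=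
    hcont.isOpen_inter_preimage hU (ContinuousLinearEquiv.isOpen)
  set V := U ∩ fderiv ℝ f ⁻¹' Set.range ((↑) : (E ≃L[ℝ] F) → E →L[ℝ] F)
  let Ψ := hfa.toOpenPartialHomeomorph f hder (by simp)
  refine ⟨Ψ.restrOpen V hV, ⟨hfa.mem_toOpenPartialHomeomorph_source hder (by simp), ha, A, hA⟩,
    fun x hx => hx.2.1, rfl, ?_⟩
  intro y hy
  have hys := (Ψ.restrOpen V hV).map_target hy
  obtain ⟨-, hyU, B, hB⟩ := hys
  refine ((Ψ.restrOpen V hV).contDiffAt_symm hy (f₀' := B) ?_ ?_).contDiffWithinAt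
  · rw [hB]
    exact ((hf.contDiffAt (hU.mem_nhds hyU)).differentiableAt (by simp)).hasFDerivAt
  · exact hf.contDiffAt (hU.mem_nhds hyU)

end InverseFunction

/-! ### Charts of level sets induced by ambient maps -/

section SubmanifoldCharts

variable {E V G : Type*} [NormedAddCommGroup E] [NormedSpace ℝ E]
  [NormedAddCommGroup V] [NormedSpace ℝ V] [NormedAddCommGroup G] [NormedSpace ℝ G]

/-- A chart of the subset `S` of `E` which extends to a smooth map on an open subset of `E` and
whose inverse is smooth as a map to `E`. -/
structure IsSubmanifoldChart (S : Set E) (c : OpenPartialHomeomorph S V) : Prop where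
  exists_extension : ∃ (U : Set E) (e : E → V), IsOpen U ∧ ContDiffOn ℝ ∞ e U ∧
    ∀ x ∈ c.source, (x : E) ∈ U ∧ c x = e x
  contDiffOn_symm : ContDiffOn ℝ ∞ (fun v => (c.symm v : E)) c.target

/-- If `S` is the zero set of `F` and `(e, F)` has an injective derivative at `q ∈ S`, then `e`
restricts to a chart of `S` around `q`. -/
theorem exists_isSubmanifoldChart_eq [FiniteDimensional ℝ E] [FiniteDimensional ℝ V]
    [FiniteDimensional ℝ G] (hdim : Module.finrank ℝ E = Module.finrank ℝ V + Module.finrank ℝ G)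
    {S : Set E} {F : E → G} (hF : ContDiff ℝ ∞ F) (hS : ∀ z, z ∈ S ↔ F z = 0) {U : Set E}
    (hU : IsOpen U) {e : E → V} (he : ContDiffOn ℝ ∞ e U) (q : S) (hq : (q : E) ∈ U)
    (hinj : ∀ v, fderiv ℝ e q v = 0 → fderiv ℝ F q v = 0 → v = 0) :
    ∃ c : OpenPartialHomeomorph S V, IsSubmanifoldChart S c ∧ q ∈ c.source ∧
      ∀ x ∈ c.source, (x : E) ∈ U ∧ c x = e x := by
  have heq : DifferentiableAt ℝ e q := (he.contDiffAt (hU.mem_nhds hq)).differentiableAt (by simp)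
  have hFq : DifferentiableAt ℝ F q := hF.differentiable (by simp) _
  obtain ⟨Φ, hqΦ, hΦU, hΦ, hΦs⟩ := exists_openPartialHomeomorph_of_injective_fderiv
    (f := fun z => (e z, F z)) (a := (q : E)) (by simpa using hdim) hU (he.prodMk hF.contDiffOn) hq
    (fun v hv => by
      rw [heq.fderiv_prodMk hFq] at hv
      exact hinj v (congrArg Prod.fst hv) (congrArg Prod.snd hv))
  have hval : ∀ v, (v, (0 : G)) ∈ Φ.target → Φ.symm (v, 0) ∈ S := fun v hv => by
    have := Φ.right_inv hv
    rw [hΦ] at this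
    exact (hS _).2 (congrArg Prod.snd this)
  have hfst : ∀ x : S, x.1 ∈ Φ.source → ((Φ x).1, (0 : G)) = Φ x := fun x hx => by
    rw [hΦ]; simp [(hS _).1 x.2]
  classical
  -- The value `q` is a default; it is never taken on the target of the chart.
  let g : V → S := fun v => if h : Φ.symm (v, 0) ∈ S then ⟨_, h⟩ else q
  have hg : ∀ v, (v, (0 : G)) ∈ Φ.target → (g v : E) = Φ.symm (v, 0) := fun v hv => by
    simp only [g, dif_pos (hval v hv)]
  let c : OpenPartialHomeomorph S V :=
    { toFun := fun x => (Φ x).1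
      invFun := g
      source := Subtype.val ⁻¹' Φ.source
      target := (fun v => (v, (0 : G))) ⁻¹' Φ.target
      map_source' := fun x hx => by
        simp only [Set.mem_preimage]
        rw [hfst x hx]; exact Φ.map_source hx
      map_target' := fun v hv => by
        simp only [Set.mem_preimage]
        rw [hg v hv]; exact Φ.map_target hv
      left_inv' := fun x hx => by
        apply Subtype.ext
        rw [hg _ (by rw [hfst x hx]; exact Φ.map_source hx), hfst x hx, Φ.left_inv hx]
      right_inv' := fun v hv => by
        rw [hg v hv, Φ.right_inv hv]
      open_source := Φ.open_source.preimage continuous_subtype_val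
      open_target := Φ.open_target.preimage (by fun_prop)
      continuousOn_toFun := continuous_fst.comp_continuousOn
        (Φ.continuousOn.comp continuous_subtype_val.continuousOn fun x hx => hx)
      continuousOn_invFun := by
        rw [Topology.IsInducing.subtypeVal.continuousOn_iff]
        refine ContinuousOn.congr (Φ.continuousOn_symm.comp (f := fun v => (v, (0 : G)))
          (by fun_prop) fun v hv => hv) fun v hv => hg v hv }
  have hc : ∀ x ∈ c.source, (x : E) ∈ U ∧ c x = e x := fun x hx =>
    ⟨hΦU hx, by change (Φ x).1 = e x; rw [hΦ]⟩
  refine ⟨c, ⟨⟨U, e, hU, he, hc⟩, ?_⟩, hqΦ, hc⟩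
  exact ContDiffOn.congr (hΦs.comp (f := fun v => (v, (0 : G))) (by fun_prop) fun v hv => hv)
    fun v hv => hg v hv

/-- The regular value theorem. -/
theorem exists_isSubmanifoldChart [FiniteDimensional ℝ E] [FiniteDimensional ℝ V]
    [FiniteDimensional ℝ G] (hdim : Module.finrank ℝ E = Module.finrank ℝ V + Module.finrank ℝ G)
    {S : Set E} {F : E → G} (hF : ContDiff ℝ ∞ F) (hS : ∀ z, z ∈ S ↔ F z = 0) (q : S)
    (hsurj : Function.Surjective (fderiv ℝ F q)) :
    ∃ c : OpenPartialHomeomorph S V, IsSubmanifoldChart S c ∧ q ∈ c.source := by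
  -- A linear projection onto the kernel of dF, identified with V, complements F.
  let K := (fderiv ℝ F q : E →ₗ[ℝ] G).ker
  obtain ⟨p, hp⟩ := LinearMap.exists_leftInverse_of_injective K.subtype (by simp)
  have hK : Module.finrank ℝ K = Module.finrank ℝ V := by
    have h1 := (fderiv ℝ F q : E →ₗ[ℝ] G).finrank_range_add_finrank_ker
    rw [LinearMap.range_eq_top.2 hsurj, finrank_top] at h1
    change _ + Module.finrank ℝ K = _ at h1
    omega
  let L : E →L[ℝ] V :=
    LinearMap.toContinuousLinearMap ((LinearEquiv.ofFinrankEq K V hK : K →ₗ[ℝ] V) ∘ₗ p)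
  obtain ⟨c, hc, hqc, -⟩ := exists_isSubmanifoldChart_eq (V := V) hdim hF hS isOpen_univ
    (e := L) L.contDiff.contDiffOn q trivial (fun v hv hFv => by
      rw [L.fderiv] at hv
      have h1 : p v = 0 := by simpa [L] using hv
      have h2 := LinearMap.congr_fun hp (⟨v, hFv⟩ : K)
      simpa [h1] using (congrArg Subtype.val h2).symm)
  exact ⟨c, hc, hqc⟩

/-- The ambient extension of `c'` turns the transition map into a composite of smooth maps between
vector spaces. -/
theorem IsSubmanifoldChart.contDiffOn_symm_trans {S : Set E} {c c' : OpenPartialHomeomorph S V}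
    (hc : IsSubmanifoldChart S c) (hc' : IsSubmanifoldChart S c') :
    ContDiffOn ℝ ∞ (c.symm ≫ₕ c') (c.symm ≫ₕ c').source := by
  obtain ⟨U, e, -, he, h⟩ := hc'.exists_extension
  have hsub : ∀ v ∈ (c.symm ≫ₕ c').source, v ∈ c.target ∧ c.symm v ∈ c'.source := fun v hv => by
    simpa using hv
  refine ContDiffOn.congr (he.comp (hc.contDiffOn_symm.mono fun v hv => (hsub v hv).1)
    fun v hv => (h _ (hsub v hv).2).1) fun v hv => ?_
  exact (h _ (hsub v hv).2).2

/-- The charted space structure given by a choice of submanifold charts. -/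
noncomputable abbrev chartedSpaceOfSubmanifoldCharts {S : Set E}
    (c : S → OpenPartialHomeomorph S V) (hmem : ∀ x, x ∈ (c x).source) : ChartedSpace V S where
  atlas := Set.range c
  chartAt := c
  mem_chart_source := hmem
  chart_mem_atlas := Set.mem_range_self

theorem isManifold_chartedSpaceOfSubmanifoldCharts {S : Set E}
    (c : S → OpenPartialHomeomorph S V) (hmem : ∀ x, x ∈ (c x).source)
    (hc : ∀ x, IsSubmanifoldChart S (c x)) :
    @IsManifold ℝ _ V _ _ V _ 𝓘(ℝ, V) ∞ S _ (chartedSpaceOfSubmanifoldCharts c hmem) := by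
  let _ := chartedSpaceOfSubmanifoldCharts c hmem
  refine isManifold_of_contDiffOn _ _ _ ?_
  rintro _ _ ⟨x, rfl⟩ ⟨y, rfl⟩
  simpa using (hc x).contDiffOn_symm_trans (hc y)

end SubmanifoldCharts

/-! ### Immersions from injective differentials -/

section Immersions

variable {E E' : Type*} [NormedAddCommGroup E] [NormedSpace ℝ E] [FiniteDimensional ℝ E]
  [NormedAddCommGroup E'] [NormedSpace ℝ E'] [FiniteDimensional ℝ E']
  {M N : Type*} [TopologicalSpace M] [ChartedSpace E M] [IsManifold 𝓘(ℝ, E) ∞ M]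
  [TopologicalSpace N] [ChartedSpace E' N] [IsManifold 𝓘(ℝ, E') ∞ N]

/-- A smooth map with injective differential at a point has there the normal form `u ↦ (u, 0)`. -/
theorem isImmersionAtOfComplement_of_injective_mfderiv {f : M → N}
    (hf : ContMDiff 𝓘(ℝ, E) 𝓘(ℝ, E') ∞ f) {x : M}
    (hinj : Function.Injective (mfderiv 𝓘(ℝ, E) 𝓘(ℝ, E') f x)) :
    Manifold.IsImmersionAtOfComplement
      (EuclideanSpace ℝ (Fin (Module.finrank ℝ E' - Module.finrank ℝ E)))
      𝓘(ℝ, E) 𝓘(ℝ, E') ∞ f x := by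
  -- This complement depends only on the two dimensions, so one space serves at all points, as a
  -- global immersion requires.
  set F := EuclideanSpace ℝ (Fin (Module.finrank ℝ E' - Module.finrank ℝ E))
  set φ := chartAt E x
  set ψ := chartAt E' (f x)
  let s : Set E := φ.target ∩ φ.symm ⁻¹' (f ⁻¹' ψ.source)
  have hs : IsOpen s :=
    φ.symm.isOpen_inter_preimage (ψ.open_source.preimage hf.continuous)
  let g : E → E' := ψ ∘ f ∘ φ.symm
  have hg : ContDiffOn ℝ ∞ g s := by
    rw [← contMDiffOn_iff_contDiffOn]
    exact (contMDiffOn_chart (I := 𝓘(ℝ, E')) (n := ∞) (x := f x)).comp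
      (hf.comp_contMDiffOn ((contMDiffOn_chart_symm (I := 𝓘(ℝ, E)) (n := ∞) (x := x)).mono
        fun u hu => hu.1)) fun u hu => hu.2
  have hxs : φ x ∈ s := ⟨φ.map_source (mem_chart_source E x), by
    simp only [Set.mem_preimage]
    rw [φ.left_inv (mem_chart_source E x)]; exact mem_chart_source E' (f x)⟩
  let A : E →L[ℝ] E' := fderiv ℝ g (φ x)
  have hA : Function.Injective A := by
    rw [(hf.mdifferentiable (by simp) x).mfderiv] at hinj
    simp only [writtenInExtChartAt, extChartAt, mfld_simps, fderivWithin_univ] at hinj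
    exact hinj
  obtain ⟨K, hK⟩ := Submodule.exists_isCompl (A : E →ₗ[ℝ] E').range
  have hrank : Module.finrank ℝ (A : E →ₗ[ℝ] E').range = Module.finrank ℝ E :=
    LinearMap.finrank_range_of_inj hA
  have hKF : Module.finrank ℝ F = Module.finrank ℝ K := by
    have := Submodule.finrank_add_eq_of_isCompl hK
    simp only [F, finrank_euclideanSpace, Fintype.card_fin]
    omega
  have hdim : Module.finrank ℝ (E × F) = Module.finrank ℝ E' := by
    rw [Module.finrank_prod, hKF, ← hrank]
    exact Submodule.finrank_add_eq_of_isCompl hK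
  let B : F →L[ℝ] E' := LinearMap.toContinuousLinearMap
    (K.subtype ∘ₗ (LinearEquiv.ofFinrankEq F K hKF : F →ₗ[ℝ] K))
  have hB : ∀ w, B w ∈ K := fun w => by simp [B]
  have hAB : ∀ p : E × F, A p.1 + B p.2 = 0 → p = 0 := by
    rintro ⟨u, w⟩ h
    have h1 : A u ∈ (A : E →ₗ[ℝ] E').range ⊓ K := by
      refine ⟨⟨u, rfl⟩, ?_⟩
      have : A u = -B w := eq_neg_of_add_eq_zero_left h
      rw [this]; exact K.neg_mem (hB w)
    rw [hK.inf_eq_bot, Submodule.mem_bot] at h1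
    have hu : u = 0 := hA (by simpa using h1)
    have hw : B w = 0 := by simpa [h1] using h
    have hw' : w = 0 := by simpa [B] using hw
    simp [hu, hw']
  let equiv : (E × F) ≃L[ℝ] E' := (LinearEquiv.ofInjectiveOfFinrankEq
    ((A.coprod B : E × F →L[ℝ] E') : E × F →ₗ[ℝ] E')
    ((injective_iff_map_eq_zero _).2 fun p hp => hAB p (by simpa using hp))
    hdim).toContinuousLinearEquiv
  -- Thickening `g` in the directions complementary to the image of its derivative gives a local
  -- diffeomorphism equal to `g` on w = 0; its inverse straightens the image.
  obtain ⟨Φ, hxΦ, hΦs, hΦ, hΦsymm⟩ := exists_openPartialHomeomorph_of_injective_fderiv hdim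
    (f := fun p : E × F => g p.1 + B p.2) (U := s ×ˢ Set.univ) (a := (φ x, 0))
    (hs.prod isOpen_univ)
    ((hg.comp contDiff_fst.contDiffOn fun p hp => hp.1).add
      (B.contDiff.comp contDiff_snd).contDiffOn) ⟨hxs, trivial⟩ (fun p hp => by
        have hgd : HasFDerivAt g A (φ x) :=
          ((hg.contDiffAt (hs.mem_nhds hxs)).differentiableAt (by simp)).hasFDerivAt
        have h1 : HasFDerivAt (fun p : E × F => g p.1 + B p.2)
            (A.comp (ContinuousLinearMap.fst ℝ E F) + B.comp (ContinuousLinearMap.snd ℝ E F))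
            (φ x, 0) :=
          (HasFDerivAt.comp (φ x, (0 : F)) hgd hasFDerivAt_fst).add
            (B.hasFDerivAt.comp (φ x, (0 : F)) hasFDerivAt_snd)
        rw [h1.fderiv] at hp
        exact hAB p (by simpa using hp))
  let χ : OpenPartialHomeomorph E' E' := Φ.symm ≫ₕ equiv.toHomeomorph.toOpenPartialHomeomorph
  have hΦsmooth : ContDiffOn ℝ ∞ Φ Φ.source := by
    rw [hΦ]
    exact ((hg.comp contDiff_fst.contDiffOn fun p hp => (hΦs hp).1).add
      (B.contDiff.comp contDiff_snd).contDiffOn)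
  let codChart := ψ ≫ₕ χ
  have hcod : codChart ∈ IsManifold.maximalAtlas 𝓘(ℝ, E') ∞ N := by
    refine codChart.mem_maximalAtlas_of_contMDiffOn ?_ ?_
    · have h1 : ContMDiffOn 𝓘(ℝ, E') 𝓘(ℝ, E') ∞ (equiv ∘ Φ.symm) Φ.target :=
        contMDiffOn_iff_contDiffOn.2 (equiv.contDiff.comp_contDiffOn hΦsymm)
      exact h1.comp ((contMDiffOn_chart (I := 𝓘(ℝ, E')) (n := ∞) (x := f x)).mono
        fun y hy => hy.1) fun y hy => by
          have := hy.2
          simpa [χ] using this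
    · have h1 : ContMDiffOn 𝓘(ℝ, E') 𝓘(ℝ, E') ∞ (Φ ∘ equiv.symm) (equiv.symm ⁻¹' Φ.source) :=
        contMDiffOn_iff_contDiffOn.2
          (hΦsmooth.comp equiv.symm.contDiff.contDiffOn fun y hy => hy)
      have h2 : ∀ y ∈ codChart.target, equiv.symm y ∈ Φ.source ∧ Φ (equiv.symm y) ∈ ψ.target :=
        fun y hy => by simpa [codChart, χ] using hy
      exact (contMDiffOn_chart_symm (I := 𝓘(ℝ, E')) (n := ∞) (x := f x)).comp
        (h1.mono fun y hy => (h2 y hy).1) fun y hy => (h2 y hy).2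
  let t : Set M := φ.source ∩ φ ⁻¹' ((fun u => (u, (0 : F))) ⁻¹' Φ.source)
  have ht : IsOpen t := φ.isOpen_inter_preimage (Φ.open_source.preimage (by fun_prop))
  have hgΦ : ∀ u, (u, (0 : F)) ∈ Φ.source → g u = Φ (u, 0) := fun u _ => by
    rw [hΦ]; simp
  have key : ∀ y ∈ t, f y ∈ codChart.source ∧ codChart (f y) = equiv (φ y, 0) := by
    rintro y ⟨hy, hyΦ⟩
    have h1 : ψ (f y) = Φ (φ y, 0) := by
      rw [← hgΦ _ hyΦ]; simp [g, φ.left_inv hy]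
    have h2 : f y ∈ ψ.source := by
      have := (hΦs hyΦ).1.2
      simpa [φ.left_inv hy] using this
    refine ⟨⟨h2, ?_⟩, ?_⟩
    · simp only [χ, Set.mem_preimage, OpenPartialHomeomorph.trans_source,
        OpenPartialHomeomorph.symm_source]
      refine ⟨?_, by simp⟩
      change ψ (f y) ∈ Φ.target
      rw [h1]; exact Φ.map_source hyΦ
    · simp only [codChart, χ, OpenPartialHomeomorph.coe_trans, Function.comp_apply, h1,
        Φ.left_inv hyΦ]
      rfl
  have hsource : (φ.restr t).source ⊆ t := fun y hy => interior_subset hy.2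
  refine Manifold.IsImmersionAtOfComplement.mk_of_charts equiv (φ.restr t) codChart
    ⟨mem_chart_source E x, mem_interior_iff_mem_nhds.2
      (ht.mem_nhds ⟨mem_chart_source E x, hxΦ⟩)⟩ (key x ⟨mem_chart_source E x, hxΦ⟩).1
    (restr_mem_maximalAtlas (contDiffGroupoid ∞ 𝓘(ℝ, E))
      (IsManifold.chart_mem_maximalAtlas (I := 𝓘(ℝ, E)) (n := ∞) x) ht)
    hcod (fun y hy => (key y (hsource hy)).1) ?_
  intro u hu
  have hu' : u ∈ (φ.restr t).target := by simpa using hu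
  have h2 := (key _ (hsource ((φ.restr t).map_target hu'))).2
  have h3 : φ ((φ.restr t).symm u) = u := (φ.restr t).right_inv hu'
  rw [h3] at h2
  simpa using h2

/-- A smooth map with injective differentials is an immersion. -/
theorem isImmersion_of_injective_mfderiv {f : M → N} (hf : ContMDiff 𝓘(ℝ, E) 𝓘(ℝ, E') ∞ f)
    (hinj : ∀ x, Function.Injective (mfderiv 𝓘(ℝ, E) 𝓘(ℝ, E') f x)) :
    Manifold.IsImmersion 𝓘(ℝ, E) 𝓘(ℝ, E') ∞ f :=
  Manifold.IsImmersionOfComplement.isImmersion fun x =>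
    isImmersionAtOfComplement_of_injective_mfderiv hf (hinj x)

end Immersions

/-! ### Compatibility of ambient charts with a given submanifold structure -/

section Submanifolds

variable {E V : Type*} [NormedAddCommGroup E] [NormedSpace ℝ E]
  [NormedAddCommGroup V] [NormedSpace ℝ V] {S : Set E} [ChartedSpace V S]

/-- The chart is smooth because it restricts a smooth ambient map; smoothness of its inverse may be
tested after composing with the inclusion, an immersion. -/
theorem IsSubmanifoldChart.mem_maximalAtlas [IsManifold 𝓘(ℝ, V) ∞ S]
    (hS : Manifold.IsImmersion 𝓘(ℝ, V) 𝓘(ℝ, E) ∞ (Subtype.val : S → E))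
    {c : OpenPartialHomeomorph S V} (hc : IsSubmanifoldChart S c) :
    c ∈ IsManifold.maximalAtlas 𝓘(ℝ, V) ∞ S := by
  obtain ⟨U, e, hU, he, h⟩ := hc.exists_extension
  refine c.mem_maximalAtlas_of_contMDiffOn ?_ ?_
  · exact ((contMDiffOn_iff_contDiffOn.2 he).comp hS.contMDiff.contMDiffOn
      fun x hx => (h x hx).1).congr fun x hx => (h x hx).2
  · intro v hv
    refine ContMDiffAt.contMDiffWithinAt ?_
    rw [ContMDiffAt.iff_comp_isImmersionAt (hS.isImmersionAt (c.symm v))]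
    exact ⟨c.symm.continuousAt hv, contMDiffAt_iff_contDiffAt.2
      (hc.contDiffOn_symm.contDiffAt (c.open_target.mem_nhds hv))⟩

/-- Near `q` the chart is an ambient map after the inclusion, and its differential is injective,
hence so is that of the first factor. -/
theorem IsSubmanifoldChart.mfderiv_val_injective {c : OpenPartialHomeomorph S V}
    (hc : IsSubmanifoldChart S c) (hcS : c ∈ IsManifold.maximalAtlas 𝓘(ℝ, V) ∞ S) {q : S}
    (hq : q ∈ c.source) (hval : MDifferentiableAt 𝓘(ℝ, V) 𝓘(ℝ, E) (Subtype.val : S → E) q) :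
    Function.Injective (mfderiv 𝓘(ℝ, V) 𝓘(ℝ, E) (Subtype.val : S → E) q) := by
  obtain ⟨U, e, hU, he, h⟩ := hc.exists_extension
  have hcd : c.MDifferentiable 𝓘(ℝ, V) 𝓘(ℝ, V) :=
    ⟨(contMDiffOn_of_mem_maximalAtlas hcS).mdifferentiableOn (by simp),
      (contMDiffOn_symm_of_mem_maximalAtlas hcS).mdifferentiableOn (by simp)⟩
  have hinj := hcd.mfderiv_injective hq
  have heq : (c : S → V) =ᶠ[𝓝 q] e ∘ Subtype.val := by
    filter_upwards [c.open_source.mem_nhds hq] with x hx using (h x hx).2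
  have hed : MDifferentiableAt 𝓘(ℝ, E) 𝓘(ℝ, V) e q := mdifferentiableAt_iff_differentiableAt.2
    ((he.contDiffAt (hU.mem_nhds (h q hq).1)).differentiableAt (by simp))
  rw [heq.mfderiv_eq, mfderiv_comp q hed hval] at hinj
  exact Function.Injective.of_comp (f := mfderiv 𝓘(ℝ, E) 𝓘(ℝ, V) e q) hinj

end Submanifolds

/-- The manifold structure given by submanifold charts makes `S` a smooth submanifold. -/
theorem isSmoothEmbedding_chartedSpaceOfSubmanifoldCharts {E V : Type*} [NormedAddCommGroup E]
    [NormedSpace ℝ E] [FiniteDimensional ℝ E] [NormedAddCommGroup V] [NormedSpace ℝ V]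
    [FiniteDimensional ℝ V] {S : Set E}
    (c : S → OpenPartialHomeomorph S V) (hmem : ∀ x, x ∈ (c x).source)
    (hc : ∀ x, IsSubmanifoldChart S (c x)) :
    letI := chartedSpaceOfSubmanifoldCharts c hmem
    Manifold.IsSmoothEmbedding 𝓘(ℝ, V) 𝓘(ℝ, E) ∞ (Subtype.val : S → E) := by
  let _ := chartedSpaceOfSubmanifoldCharts c hmem
  have _ := isManifold_chartedSpaceOfSubmanifoldCharts c hmem hc
  have hval : ContMDiff 𝓘(ℝ, V) 𝓘(ℝ, E) ∞ (Subtype.val : S → E) := by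
    intro x
    rw [contMDiffAt_iff_source (I := 𝓘(ℝ, V)) (x := x)]
    refine ContMDiffAt.contMDiffWithinAt (contMDiffAt_iff_contDiffAt.2 ?_)
    exact (hc x).contDiffOn_symm.contDiffAt
      ((c x).open_target.mem_nhds ((c x).map_source (hmem x)))
  refine ⟨isImmersion_of_injective_mfderiv hval fun x => ?_, .subtypeVal⟩
  exact (hc x).mfderiv_val_injective (IsManifold.chart_mem_maximalAtlas x) (hmem x)
    (hval.mdifferentiable (by simp) x)

noncomputable section

/-! ### The link as a regular level set and its tangent space -/

section Link

variable {k n : ℕ}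

/-- The real coordinates of `ℂⁿ⁺¹`. -/
def coordCLM (j : Fin (n + 1)) : EuclideanSpace ℂ (Fin (n + 1)) →L[ℝ] ℂ :=
  (EuclideanSpace.proj j : EuclideanSpace ℂ (Fin (n + 1)) →L[ℂ] ℂ).restrictScalars ℝ

@[simp] theorem coordCLM_apply (j : Fin (n + 1)) (z : EuclideanSpace ℂ (Fin (n + 1))) :
    coordCLM j z = z j := rfl

/-- The defining map of the link. -/
def linkEquation (n : ℕ) (z : EuclideanSpace ℂ (Fin (n + 1))) : ℂ × ℝ :=
  (sumSquares n z, ∑ j, ((z j).re ^ 2 + (z j).im ^ 2) - 1)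

theorem sum_re_sq_add_im_sq (z : EuclideanSpace ℂ (Fin (n + 1))) :
    ∑ j, ((z j).re ^ 2 + (z j).im ^ 2) = ‖z‖ ^ 2 := by
  rw [EuclideanSpace.norm_sq_eq]
  refine Finset.sum_congr rfl fun j _ => ?_
  rw [Complex.sq_norm, Complex.normSq_apply]; ring

theorem mem_link_iff (z : EuclideanSpace ℂ (Fin (n + 1))) :
    z ∈ link n ↔ linkEquation n z = 0 := by
  simp only [link, linkEquation, Set.mem_ofPred_eq, Prod.mk_eq_zero, sum_re_sq_add_im_sq]
  refine and_congr_right fun _ => ?_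
  rw [sub_eq_zero, pow_eq_one_iff_of_nonneg (norm_nonneg z) two_ne_zero]

theorem hasFDerivAt_linkEquation (q : EuclideanSpace ℂ (Fin (n + 1))) :
    HasFDerivAt (linkEquation n)
      ((∑ j, (2 * q j) • coordCLM j).prod
        (∑ j, ((2 * (q j).re) • Complex.reCLM.comp (coordCLM j) +
          (2 * (q j).im) • Complex.imCLM.comp (coordCLM j)))) q := by
  refine HasFDerivAt.prodMk ?_ (HasFDerivAt.sub_const 1 ?_)
  · refine HasFDerivAt.fun_sum fun j _ => ?_
    refine (((coordCLM j).hasFDerivAt (x := q)).pow 2).congr_fderiv ?_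
    ext v
    simp
  · refine HasFDerivAt.fun_sum fun j _ => HasFDerivAt.add ?_ ?_
    · refine (((Complex.reCLM.comp (coordCLM j)).hasFDerivAt (x := q)).pow 2).congr_fderiv ?_
      ext v
      simp
    · refine (((Complex.imCLM.comp (coordCLM j)).hasFDerivAt (x := q)).pow 2).congr_fderiv ?_
      ext v
      simp

theorem fderiv_linkEquation (q v : EuclideanSpace ℂ (Fin (n + 1))) :
    fderiv ℝ (linkEquation n) q v =
      (2 * ∑ j, q j * v j, 2 * ∑ j, ((q j).re * (v j).re + (q j).im * (v j).im)) := by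
  rw [(hasFDerivAt_linkEquation q).fderiv]
  simp [Finset.mul_sum, mul_add, mul_assoc]

theorem contDiff_linkEquation : ContDiff ℝ ∞ (linkEquation n) := by
  refine ContDiff.prodMk ?_ (ContDiff.sub ?_ contDiff_const)
  · exact ContDiff.sum fun j _ => (coordCLM j).contDiff.pow 2
  · exact ContDiff.sum fun j _ => ((Complex.reCLM.comp (coordCLM j)).contDiff.pow 2).add
      ((Complex.imCLM.comp (coordCLM j)).contDiff.pow 2)

theorem sumSquares_eq_zero (q : link n) : ∑ j, q.1 j * q.1 j = 0 := by
  simpa [sumSquares, sq] using q.2.1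

theorem sum_normSq_eq_one (q : link n) : ∑ j, ((q.1 j).re ^ 2 + (q.1 j).im ^ 2) = 1 := by
  rw [sum_re_sq_add_im_sq, q.2.2, one_pow]

theorem sum_mul_conj_eq_one (q : link n) : ∑ j, q.1 j * (starRingEnd ℂ) (q.1 j) = 1 := by
  have h := congrArg (fun x : ℝ => (x : ℂ)) (sum_normSq_eq_one q)
  simp only [Complex.ofReal_sum, Complex.ofReal_one] at h
  rw [← h]
  refine Finset.sum_congr rfl fun j _ => ?_
  rw [Complex.mul_conj, Complex.normSq_apply]; push_cast; ring

/-- Since Σ qⱼ² = 0 and Σ qⱼq̄ⱼ = 1, complex multiples of q̄ change only f to first order, and real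
multiples of q only the norm. -/
theorem fderiv_linkEquation_surjective (q : link n) :
    Function.Surjective (fderiv ℝ (linkEquation n) q) := by
  rintro ⟨c, r⟩
  refine ⟨WithLp.toLp 2 fun j => c / 2 * (starRingEnd ℂ) (q.1 j) + (r / 2 : ℝ) * q.1 j, ?_⟩
  have hre : ∀ x y : ℂ, x.re * y.re + x.im * y.im = ((starRingEnd ℂ) x * y).re := by
    intro x y; simp
  have hq : ∑ j, (starRingEnd ℂ) (q.1 j) * (starRingEnd ℂ) (q.1 j) = 0 := by
    have := congrArg (starRingEnd ℂ) (sumSquares_eq_zero q)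
    simpa using this
  rw [fderiv_linkEquation]
  simp only [hre, ← Complex.re_sum]
  have h1 : ∑ j, q.1 j * (c / 2 * (starRingEnd ℂ) (q.1 j) + (r / 2 : ℝ) * q.1 j) = c / 2 := by
    calc _ = c / 2 * ∑ j, q.1 j * (starRingEnd ℂ) (q.1 j) + (r / 2 : ℝ) * ∑ j, q.1 j * q.1 j := by
          rw [Finset.mul_sum, Finset.mul_sum, ← Finset.sum_add_distrib]
          exact Finset.sum_congr rfl fun j _ => by ring
      _ = _ := by rw [sum_mul_conj_eq_one, sumSquares_eq_zero]; ring
  have h2 : ∑ j, (starRingEnd ℂ) (q.1 j) *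
      (c / 2 * (starRingEnd ℂ) (q.1 j) + (r / 2 : ℝ) * q.1 j) = (r / 2 : ℝ) := by
    calc _ = c / 2 * ∑ j, (starRingEnd ℂ) (q.1 j) * (starRingEnd ℂ) (q.1 j) +
          (r / 2 : ℝ) * ∑ j, q.1 j * (starRingEnd ℂ) (q.1 j) := by
          rw [Finset.mul_sum, Finset.mul_sum, ← Finset.sum_add_distrib]
          exact Finset.sum_congr rfl fun j _ => by ring
      _ = _ := by rw [sum_mul_conj_eq_one, hq]; ring
  rw [h1, h2, Complex.ofReal_re]
  ext <;> simp <;> ring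

theorem finrank_linkSpace :
    Module.finrank ℝ (EuclideanSpace ℂ (Fin (k + 1 + 1))) =
      Module.finrank ℝ (EuclideanSpace ℝ (Fin (2 * (k + 1) - 1))) + Module.finrank ℝ (ℂ × ℝ) := by
  rw [finrank_real_of_complex, finrank_euclideanSpace, finrank_euclideanSpace,
    Module.finrank_prod, Complex.finrank_real_complex, Module.finrank_self]
  simp only [Fintype.card_fin]
  omega

instance finiteDimensional_linkSpace : FiniteDimensional ℝ (EuclideanSpace ℂ (Fin (n + 1))) :=
  FiniteDimensional.complexToReal _

theorem exists_isSubmanifoldChart_link (q : link (k + 1)) :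
    ∃ c : OpenPartialHomeomorph (link (k + 1)) (EuclideanSpace ℝ (Fin (2 * (k + 1) - 1))),
      IsSubmanifoldChart (link (k + 1)) c ∧ q ∈ c.source :=
  exists_isSubmanifoldChart finrank_linkSpace contDiff_linkEquation mem_link_iff q
    (fderiv_linkEquation_surjective q)

theorem exists_isSubmanifoldAtlas (k : ℕ) :
    ∃ cs : ChartedSpace (EuclideanSpace ℝ (Fin (2 * (k + 1) - 1))) (link (k + 1)),
      IsSubmanifoldAtlas (k + 1) cs := by
  choose c hc hmem using exists_isSubmanifoldChart_link (k := k)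
  exact ⟨chartedSpaceOfSubmanifoldCharts c hmem,
    isManifold_chartedSpaceOfSubmanifoldCharts c hmem hc,
    isSmoothEmbedding_chartedSpaceOfSubmanifoldCharts c hmem hc⟩

variable [cs : ChartedSpace (EuclideanSpace ℝ (Fin (2 * (k + 1) - 1))) (link (k + 1))]

theorem IsSubmanifoldAtlas.mem_maximalAtlas (h : IsSubmanifoldAtlas (k + 1) cs)
    {c : OpenPartialHomeomorph (link (k + 1)) (EuclideanSpace ℝ (Fin (2 * (k + 1) - 1)))}
    (hc : IsSubmanifoldChart (link (k + 1)) c) :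
    c ∈ IsManifold.maximalAtlas (𝓡 (2 * (k + 1) - 1)) ∞ (link (k + 1)) :=
  have := h.1
  hc.mem_maximalAtlas h.2.isImmersion

theorem IsSubmanifoldAtlas.mdifferentiableAt_val (h : IsSubmanifoldAtlas (k + 1) cs)
    (q : link (k + 1)) :
    MDifferentiableAt (𝓡 (2 * (k + 1) - 1)) 𝓘(ℝ, EuclideanSpace ℂ (Fin (k + 1 + 1)))
      (Subtype.val : link (k + 1) → _) q :=
  h.2.contMDiff.mdifferentiable (by simp) q

theorem IsSubmanifoldAtlas.mfderiv_val_injective (h : IsSubmanifoldAtlas (k + 1) cs)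
    (q : link (k + 1)) :
    Function.Injective (mfderiv (𝓡 (2 * (k + 1) - 1))
      𝓘(ℝ, EuclideanSpace ℂ (Fin (k + 1 + 1))) (Subtype.val : link (k + 1) → _) q) := by
  obtain ⟨c, hc, hqc⟩ := exists_isSubmanifoldChart_link q
  exact hc.mfderiv_val_injective (h.mem_maximalAtlas hc) hqc (h.mdifferentiableAt_val q)

/-- The differential of the inclusion of the link. -/
def inclusionDeriv (q : link (k + 1)) :
    EuclideanSpace ℝ (Fin (2 * (k + 1) - 1)) →L[ℝ] EuclideanSpace ℂ (Fin (k + 1 + 1)) :=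
  mfderiv (𝓡 (2 * (k + 1) - 1)) 𝓘(ℝ, EuclideanSpace ℂ (Fin (k + 1 + 1)))
    (Subtype.val : link (k + 1) → _) q

/-- The tangent space of the link. -/
theorem IsSubmanifoldAtlas.exists_inclusionDeriv_eq_iff (h : IsSubmanifoldAtlas (k + 1) cs)
    (q : link (k + 1)) (v : EuclideanSpace ℂ (Fin (k + 1 + 1))) :
    (∃ u, inclusionDeriv q u = v) ↔ fderiv ℝ (linkEquation (k + 1)) q v = 0 := by
  let D := inclusionDeriv q
  let A := fderiv ℝ (linkEquation (k + 1)) q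
  -- The defining map is constant on the link, so the image of D lies in the kernel of A; equality
  -- follows by counting dimensions.
  have hle : (D : EuclideanSpace ℝ (Fin (2 * (k + 1) - 1)) →ₗ[ℝ]
      EuclideanSpace ℂ (Fin (k + 1 + 1))).range ≤
      (A : EuclideanSpace ℂ (Fin (k + 1 + 1)) →ₗ[ℝ] ℂ × ℝ).ker := by
    rintro _ ⟨u, rfl⟩
    have hd : DifferentiableAt ℝ (linkEquation (k + 1)) q :=
      contDiff_linkEquation.differentiable (by simp) _
    have h1 := mfderiv_comp q (mdifferentiableAt_iff_differentiableAt.2 hd)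
      (h.mdifferentiableAt_val q)
    have h2 : linkEquation (k + 1) ∘ (Subtype.val : link (k + 1) → _) = fun _ => 0 := by
      ext1 x; exact (mem_link_iff _).1 x.2
    rw [h2, mfderiv_const, mfderiv_eq_fderiv] at h1
    exact (DFunLike.congr_fun h1 u).symm
  have hrank : Module.finrank ℝ (D : EuclideanSpace ℝ (Fin (2 * (k + 1) - 1)) →ₗ[ℝ]
      EuclideanSpace ℂ (Fin (k + 1 + 1))).range =
      Module.finrank ℝ (A : EuclideanSpace ℂ (Fin (k + 1 + 1)) →ₗ[ℝ] ℂ × ℝ).ker := by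
    have hD : Function.Injective D := h.mfderiv_val_injective q
    rw [LinearMap.finrank_range_of_inj hD]
    have h1 := (A : EuclideanSpace ℂ (Fin (k + 1 + 1)) →ₗ[ℝ] ℂ × ℝ).finrank_range_add_finrank_ker
    rw [LinearMap.range_eq_top.2 (fderiv_linkEquation_surjective q), finrank_top,
      finrank_linkSpace] at h1
    omega
  have heq := Submodule.eq_of_le_of_finrank_eq hle hrank
  have := SetLike.ext_iff.1 heq v
  exact this

end Link
-- The singular set: two circles
section SingularSet

variable {k n : ℕ}

/-- The isometry `ℂ = ℝ²`. -/
def planeIso : ℂ ≃ₗᵢ[ℝ] EuclideanSpace ℝ (Fin 2) := Complex.orthonormalBasisOneI.repr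

theorem planeIso_apply (c : ℂ) : planeIso c = !₂[c.re, c.im] := by
  ext i
  simp [planeIso, Complex.orthonormalBasisOneI_repr_apply]

/-- `linearForm` as a real linear map. -/
def linearFormCLM (n : ℕ) : EuclideanSpace ℂ (Fin (n + 1)) →L[ℝ] ℂ :=
  coordCLM 0 + (Complex.I / 2) • coordCLM 1

theorem linearFormCLM_apply (z : EuclideanSpace ℂ (Fin (n + 1))) :
    linearFormCLM n z = linearForm n z := by
  simp [linearFormCLM, linearForm]

/-- The linear map `ℂⁿ⁺¹ → ℝ²` which restricts to `linkMap`. -/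
def linkMapCLM (n : ℕ) : EuclideanSpace ℂ (Fin (n + 1)) →L[ℝ] EuclideanSpace ℝ (Fin 2) :=
  (planeIso.toContinuousLinearEquiv : ℂ →L[ℝ] EuclideanSpace ℝ (Fin 2)).comp (linearFormCLM n)

theorem linkMapCLM_apply (z : EuclideanSpace ℂ (Fin (n + 1))) :
    linkMapCLM n z = planeIso (linearForm n z) := by
  rw [← linearFormCLM_apply]; rfl

theorem linkMap_eq (z : link n) : linkMap n z = planeIso (linearForm n z) := by
  rw [planeIso_apply]; rfl

theorem linkMap_eq_comp : linkMap n = linkMapCLM n ∘ Subtype.val := by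
  ext1 z; rw [linkMap_eq, ← linkMapCLM_apply]; rfl

/-- The coordinate `z₁ - δ √-1 z₂`. -/
def isotropic (δ : ℝ) (z : EuclideanSpace ℂ (Fin (k + 1 + 1))) : ℂ := z 0 - δ * Complex.I * z 1

theorem sum_succ_succ {A : Type*} [AddCommMonoid A] (f : Fin (k + 1 + 1) → A) :
    ∑ j, f j = f 0 + f 1 + ∑ j : Fin k, f j.succ.succ := by
  rw [Fin.sum_univ_succ, Fin.sum_univ_succ, ← add_assoc]; rfl

theorem sumSquares_eq_isotropic {δ : ℝ} (hδ : δ ^ 2 = 1) (z : EuclideanSpace ℂ (Fin (k + 1 + 1))) :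
    sumSquares (k + 1) z =
      isotropic δ z * isotropic (-δ) z + ∑ j : Fin k, z j.succ.succ ^ 2 := by
  have h : (δ : ℂ) ^ 2 = 1 := by exact_mod_cast hδ
  rw [sumSquares, sum_succ_succ, isotropic, isotropic]
  push_cast
  linear_combination (-(z 1) ^ 2) * h + ((δ : ℂ) ^ 2 * z 1 ^ 2) * Complex.I_sq

/-- The two coefficients are 1/4 and 3/4. The one at the coordinate surviving on a singular circle,
times √2, is the critical radius. -/
theorem linearForm_eq_isotropic {δ : ℝ} (hδ : δ ^ 2 = 1)
    (z : EuclideanSpace ℂ (Fin (k + 1 + 1))) :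
    linearForm (k + 1) z =
      ((2 + δ) * isotropic (-δ) z + (2 - δ) * isotropic δ z) / 4 := by
  have h : (δ : ℂ) ^ 2 = 1 := by exact_mod_cast hδ
  rw [linearForm, isotropic, isotropic]
  push_cast
  linear_combination (-(Complex.I * z 1) / 2) * h

theorem normSq_isotropic_add {δ : ℝ} (hδ : δ ^ 2 = 1) (z : EuclideanSpace ℂ (Fin (k + 1 + 1))) :
    Complex.normSq (isotropic δ z) + Complex.normSq (isotropic (-δ) z) =
      2 * ((z 0).re ^ 2 + (z 0).im ^ 2) + 2 * ((z 1).re ^ 2 + (z 1).im ^ 2) := by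
  simp only [isotropic, Complex.normSq_apply, Complex.sub_re, Complex.sub_im, Complex.mul_re,
    Complex.mul_im, Complex.ofReal_re, Complex.ofReal_im, Complex.I_re, Complex.I_im,
    Complex.ofReal_neg, Complex.neg_re, Complex.neg_im]
  linear_combination (2 * ((z 1).re ^ 2 + (z 1).im ^ 2)) * hδ

/-- The circles of singular points of `linkMap`. -/
def singularCircle (k : ℕ) (δ : ℝ) : Set (link (k + 1)) :=
  {q | isotropic (-δ) q.1 = 0 ∧ ∀ j : Fin k, q.1 j.succ.succ = 0}

theorem normSq_isotropic_of_mem_singularCircle {δ : ℝ} (hδ : δ ^ 2 = 1) {q : link (k + 1)}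
    (hq : q ∈ singularCircle k δ) : Complex.normSq (isotropic δ q.1) = 2 := by
  have h1 := sum_normSq_eq_one q
  rw [sum_succ_succ, Finset.sum_eq_zero fun j _ => by simp [hq.2 j]] at h1
  have h2 := normSq_isotropic_add hδ q.1
  rw [hq.1, map_zero] at h2
  linarith

theorem isotropic_ne_zero_of_mem_singularCircle {δ : ℝ} (hδ : δ ^ 2 = 1) {q : link (k + 1)}
    (hq : q ∈ singularCircle k δ) : isotropic δ q.1 ≠ 0 := by
  intro h
  have := normSq_isotropic_of_mem_singularCircle hδ hq
  rw [h, map_zero] at this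
  norm_num at this

/-- With zero tail the equation f = 0 reads PQ = 0. -/
theorem mem_singularCircle_or {q : link (k + 1)} (hq : ∀ j : Fin k, q.1 j.succ.succ = 0) :
    q ∈ singularCircle k 1 ∨ q ∈ singularCircle k (-1) := by
  have h1 : sumSquares (k + 1) q.1 = 0 := q.2.1
  rw [sumSquares_eq_isotropic (δ := 1) (by norm_num), Finset.sum_eq_zero fun j _ => by simp [hq j],
    add_zero, mul_eq_zero] at h1
  rcases h1 with h1 | h1
  · exact Or.inr ⟨by simpa using h1, hq⟩
  · exact Or.inl ⟨h1, hq⟩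

/-- Polarize the expressions of f and of the norm in P and Q. Where Q and the tail vanish, df(v) is
P(q)Q(v) with P(q) ≠ 0, so Q(v) = 0; the norm condition then involves only P. -/
theorem isotropic_eq_of_tangent {δ : ℝ} (hδ : δ ^ 2 = 1) {q : link (k + 1)}
    (hq : q ∈ singularCircle k δ) {v : EuclideanSpace ℂ (Fin (k + 1 + 1))}
    (hv : fderiv ℝ (linkEquation (k + 1)) q v = 0) :
    isotropic (-δ) v = 0 ∧ ((starRingEnd ℂ) (isotropic δ q.1) * isotropic δ v).re = 0 := by
  rw [fderiv_linkEquation, Prod.mk_eq_zero, sum_succ_succ, sum_succ_succ,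
    Finset.sum_eq_zero fun j _ => by simp [hq.2 j],
    Finset.sum_eq_zero fun j _ => by simp [hq.2 j]] at hv
  obtain ⟨h1, h2⟩ := hv
  have hP := isotropic_ne_zero_of_mem_singularCircle hδ hq
  have hQ := hq.1
  have h : (δ : ℂ) ^ 2 = 1 := by exact_mod_cast hδ
  have h3 : isotropic (-δ) v = 0 := by
    have : isotropic δ q.1 * isotropic (-δ) v = 0 := by
      have e : isotropic δ q.1 * isotropic (-δ) v + isotropic (-δ) q.1 * isotropic δ v =
          2 * (q.1 0 * v 0 + q.1 1 * v 1) := by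
        rw [isotropic, isotropic, isotropic, isotropic]
        push_cast
        linear_combination (2 * q.1 1 * v 1) * h - (2 * δ ^ 2 * q.1 1 * v 1) * Complex.I_sq
      rw [hQ] at e
      linear_combination e + h1
    exact (mul_eq_zero.1 this).resolve_left hP
  refine ⟨h3, ?_⟩
  have e : ((starRingEnd ℂ) (isotropic δ q.1) * isotropic δ v).re +
      ((starRingEnd ℂ) (isotropic (-δ) q.1) * isotropic (-δ) v).re =
      2 * ((q.1 0).re * (v 0).re + (q.1 0).im * (v 0).im +
        ((q.1 1).re * (v 1).re + (q.1 1).im * (v 1).im)) := by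
    simp only [isotropic, map_sub, map_mul, Complex.sub_re, Complex.sub_im, Complex.mul_re,
      Complex.mul_im, Complex.ofReal_re, Complex.ofReal_im, Complex.I_re, Complex.I_im,
      Complex.ofReal_neg, Complex.neg_re, Complex.neg_im, Complex.conj_re, Complex.conj_im]
    linear_combination (2 * ((q.1 1).re * (v 1).re + (q.1 1).im * (v 1).im)) * hδ
  rw [h3, mul_zero, Complex.zero_re] at e
  linarith

/-- On the tangent space at a point of a singular circle, the linear form is not onto. -/
theorem linearForm_ne_of_tangent {δ : ℝ} (hδ : δ ^ 2 = 1) {q : link (k + 1)}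
    (hq : q ∈ singularCircle k δ) {v : EuclideanSpace ℂ (Fin (k + 1 + 1))}
    (hv : fderiv ℝ (linkEquation (k + 1)) q v = 0) :
    linearForm (k + 1) v ≠ linearForm (k + 1) q := by
  obtain ⟨h1, h2⟩ := isotropic_eq_of_tangent hδ hq hv
  intro h
  rw [linearForm_eq_isotropic hδ, linearForm_eq_isotropic hδ, h1, hq.1] at h
  have hδ2 : (2 - δ : ℂ) ≠ 0 := by
    intro h0
    have : (2 - δ : ℝ) = 0 := by exact_mod_cast h0
    nlinarith
  -- The radial value g(q) is the one missed: reaching it would force P(v) = P(q), whereas P(v) is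
  -- orthogonal to P(q) and |P(q)|² = 2.
  have h3 : isotropic δ v = isotropic δ q.1 := by
    have : (2 - δ : ℂ) * isotropic δ v = (2 - δ : ℂ) * isotropic δ q.1 := by
      linear_combination 4 * h
    exact mul_left_cancel₀ hδ2 this
  rw [h3, mul_comm, Complex.mul_conj, Complex.ofReal_re,
    normSq_isotropic_of_mem_singularCircle hδ hq] at h2
  norm_num at h2

/-- As qᵢ² is minus the sum of the other squares, |qᵢ|² is at most the sum of the other |qⱼ|². -/
theorem norm_sq_le_half (q : link n) (i : Fin (n + 1)) : ‖q.1 i‖ ^ 2 ≤ 1 / 2 := by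
  classical
  have h1 : ∑ j, q.1 j ^ 2 = 0 := q.2.1
  have h2 : ∑ j, ‖q.1 j‖ ^ 2 = 1 := by
    rw [← EuclideanSpace.norm_sq_eq, q.2.2, one_pow]
  rw [← Finset.add_sum_erase _ _ (Finset.mem_univ i)] at h1 h2
  have h3 : ‖q.1 i‖ ^ 2 ≤ ∑ j ∈ Finset.univ.erase i, ‖q.1 j‖ ^ 2 := by
    rw [← norm_pow, eq_neg_of_add_eq_zero_left h1, norm_neg]
    refine (norm_sum_le _ _).trans_eq (Finset.sum_congr rfl fun j _ => norm_pow _ _)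
  linarith

/-- Away from the singular circles, `linkMap` is a submersion. -/
theorem exists_tangent_linearForm_eq {q : link (k + 1)} {j : Fin k} (hj : q.1 j.succ.succ ≠ 0)
    (c : ℂ) : ∃ v, fderiv ℝ (linkEquation (k + 1)) q v = 0 ∧ linearForm (k + 1) v = c := by
  -- `a` is the conjugate of the coefficient vector of g; `v` below is its Hermitian projection to
  -- the subspace orthogonal to q and q̄.
  let a : EuclideanSpace ℂ (Fin (k + 1 + 1)) :=
    WithLp.toLp 2 (Fin.cons 1 (Fin.cons (-(Complex.I / 2)) 0))
  have ha0 : a 0 = 1 := rfl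
  have ha1 : a 1 = -(Complex.I / 2) := rfl
  have haj : ∀ i : Fin k, a i.succ.succ = 0 := fun i => rfl
  let conj := starRingEnd ℂ
  let s : ℂ := ∑ i, q.1 i * a i
  let t : ℂ := ∑ i, conj (q.1 i) * a i
  have hs : s = q.1 0 + q.1 1 * (-(Complex.I / 2)) := by
    simp only [s]; rw [sum_succ_succ]; simp [ha0, ha1, haj]
  have ht : t = conj (q.1 0) + conj (q.1 1) * (-(Complex.I / 2)) := by
    simp only [t]; rw [sum_succ_succ]; simp [ha0, ha1, haj]
  let v : EuclideanSpace ℂ (Fin (k + 1 + 1)) :=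
    WithLp.toLp 2 fun i => a i - s * conj (q.1 i) - t * q.1 i
  have hv : ∀ i, v i = a i - s * conj (q.1 i) - t * q.1 i := fun i => rfl
  have hqq := sumSquares_eq_zero q
  have hqc := sum_mul_conj_eq_one q
  have hcc : ∑ i, conj (q.1 i) * conj (q.1 i) = 0 := by
    have := congrArg conj hqq
    simpa using this
  have h1 : ∑ i, q.1 i * v i = 0 := by
    have : ∑ i, q.1 i * v i = s - s * ∑ i, q.1 i * conj (q.1 i) - t * ∑ i, q.1 i * q.1 i := by
      simp only [s]
      rw [Finset.mul_sum, Finset.mul_sum, ← Finset.sum_sub_distrib, ← Finset.sum_sub_distrib]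
      exact Finset.sum_congr rfl fun i _ => by rw [hv]; ring
    rw [this, hqc, hqq]; ring
  have h2 : ∑ i, conj (q.1 i) * v i = 0 := by
    have : ∑ i, conj (q.1 i) * v i =
        t - s * ∑ i, conj (q.1 i) * conj (q.1 i) - t * ∑ i, q.1 i * conj (q.1 i) := by
      simp only [t]
      rw [Finset.mul_sum, Finset.mul_sum, ← Finset.sum_sub_distrib, ← Finset.sum_sub_distrib]
      exact Finset.sum_congr rfl fun i _ => by rw [hv]; ring
    rw [this, hqc, hcc]; ring
  have hg : linearForm (k + 1) v ≠ 0 := by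
    -- This is the squared length of the projection, |a|² - |s|² - |t|² with |a|² = 5/4.
    have e : linearForm (k + 1) v =
        ((5 / 4 - 2 * ‖q.1 0‖ ^ 2 - ‖q.1 1‖ ^ 2 / 2 : ℝ) : ℂ) := by
      rw [linearForm, hv, hv, hs, ht, ha0, ha1]
      push_cast
      rw [← Complex.mul_conj', ← Complex.mul_conj']
      change _ = 5 / 4 - 2 * (q.1 0 * conj (q.1 0)) - (q.1 1 * conj (q.1 1)) / 2
      linear_combination (-1 / 4 + q.1 1 * conj (q.1 1) / 2) * Complex.I_sq
    rw [e, Complex.ofReal_ne_zero]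
    -- The subtracted terms are (3/2)|q₀|² + (|q₀|² + |q₁|²)/2, below 3/4 + 1/2 because the tail is
    -- not zero.
    have h0 := norm_sq_le_half q 0
    have hsum : ∑ i, ‖q.1 i‖ ^ 2 = 1 := by
      rw [← EuclideanSpace.norm_sq_eq, q.2.2, one_pow]
    rw [sum_succ_succ] at hsum
    have hpos : 0 < ∑ i : Fin k, ‖q.1 i.succ.succ‖ ^ 2 :=
      Finset.sum_pos' (fun i _ => by positivity) ⟨j, Finset.mem_univ j, by positivity⟩
    nlinarith
  -- Both equations satisfied by `v` are complex linear, so complex multiples of `v` remain tangent.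
  refine ⟨WithLp.toLp 2 fun i => c / linearForm (k + 1) v * v i, ?_, ?_⟩
  · have hre : ∀ x y : ℂ, x.re * y.re + x.im * y.im = (conj x * y).re := by
      intro x y; simp [conj]
    rw [fderiv_linkEquation]
    simp only [hre, ← Complex.re_sum]
    simp only [mul_left_comm _ (c / linearForm (k + 1) v), ← Finset.mul_sum, h1, h2]
    simp
  · have : linearForm (k + 1) (WithLp.toLp 2 fun i => c / linearForm (k + 1) v * v i) =
        c / linearForm (k + 1) v * linearForm (k + 1) v := by
      simp only [linearForm]; ring
    rw [this, div_mul_cancel₀ _ hg]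

variable [cs : ChartedSpace (EuclideanSpace ℝ (Fin (2 * (k + 1) - 1))) (link (k + 1))]

/-- As k ≥ 1, the source has dimension 2k + 1 ≥ 3, so the maximal rank is 2 and a smaller rank means
that a value is missed. -/
theorem IsSubmanifoldAtlas.mem_singularSet_iff (h : IsSubmanifoldAtlas (k + 1) cs) (hk : 1 ≤ k)
    (q : link (k + 1)) :
    q ∈ singularSet (2 * (k + 1) - 1) (linkMap (k + 1)) ↔
      ∃ c : ℂ, ∀ v, fderiv ℝ (linkEquation (k + 1)) q v = 0 → linearForm (k + 1) v ≠ c := by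
  let D : EuclideanSpace ℝ (Fin (2 * (k + 1) - 1)) →L[ℝ] EuclideanSpace ℝ (Fin 2) :=
    mfderiv (𝓡 (2 * (k + 1) - 1)) (𝓡 2) (linkMap (k + 1)) q
  have hD : ∀ u, D u = planeIso (linearForm (k + 1) (inclusionDeriv q u)) := by
    intro u
    have h1 := mfderiv_comp (I'' := 𝓡 2) q
      ((linkMapCLM (k + 1)).differentiableAt (x := q.1)).mdifferentiableAt
      (h.mdifferentiableAt_val q)
    rw [← linkMap_eq_comp, mfderiv_eq_fderiv, ContinuousLinearMap.fderiv] at h1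
    have h2 : D = (linkMapCLM (k + 1)).comp (inclusionDeriv q) := h1
    rw [h2, ContinuousLinearMap.comp_apply, linkMapCLM_apply]
  have h1 : q ∈ singularSet (2 * (k + 1) - 1) (linkMap (k + 1)) ↔
      (D : EuclideanSpace ℝ (Fin (2 * (k + 1) - 1)) →ₗ[ℝ] EuclideanSpace ℝ (Fin 2)).range ≠ ⊤ := by
    have hmin : min (2 * (k + 1) - 1) (1 + 1) =
        Module.finrank ℝ (EuclideanSpace ℝ (Fin 2)) := by
      rw [finrank_euclideanSpace_fin]; omega
    change Module.finrank ℝ (D : EuclideanSpace ℝ (Fin (2 * (k + 1) - 1)) →ₗ[ℝ]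
      EuclideanSpace ℝ (Fin 2)).range ≠ min (2 * (k + 1) - 1) (1 + 1) ↔ _
    rw [hmin]
    refine not_congr ⟨Submodule.eq_top_of_finrank_eq, fun ht => by rw [ht, finrank_top]⟩
  rw [h1, Ne, LinearMap.range_eq_top, Function.Surjective]
  push Not
  constructor
  · rintro ⟨b, hb⟩
    refine ⟨planeIso.symm b, fun v hv hvb => ?_⟩
    obtain ⟨u, hu⟩ := (h.exists_inclusionDeriv_eq_iff q v).2 hv
    refine hb u ?_
    change D u = b
    rw [hD, hu, hvb, LinearIsometryEquiv.apply_symm_apply]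
  · rintro ⟨c, hc⟩
    refine ⟨planeIso c, fun u hu => hc _ ((h.exists_inclusionDeriv_eq_iff q _).1 ⟨u, rfl⟩) ?_⟩
    change D u = _ at hu
    rw [hD] at hu
    exact planeIso.injective hu

theorem IsSubmanifoldAtlas.singularSet_eq (h : IsSubmanifoldAtlas (k + 1) cs) (hk : 1 ≤ k) :
    singularSet (2 * (k + 1) - 1) (linkMap (k + 1)) =
      singularCircle k (-1) ∪ singularCircle k 1 := by
  ext q
  rw [h.mem_singularSet_iff hk]
  constructor
  · rintro ⟨c, hc⟩
    refine (mem_singularCircle_or fun j => ?_).symm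
    by_contra hj
    obtain ⟨v, hv, hvc⟩ := exists_tangent_linearForm_eq hj c
    exact hc v hv hvc
  · rintro (hq | hq)
    · exact ⟨_, fun v hv => linearForm_ne_of_tangent (by norm_num) hq hv⟩
    · exact ⟨_, fun v hv => linearForm_ne_of_tangent (by norm_num) hq hv⟩

end SingularSet
-- Explicit diagonalization of |g|² near a singular circle
section FoldCoordinates

variable {k : ℕ}

/-- Splitting of the index set of the coordinates of the normal form: the first coordinate, and two
groups of `k` coordinates. -/
def foldIndex (k : ℕ) : Fin (2 * (k + 1) - 1) ≃ Option (Fin k ⊕ Fin k) :=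
  (finCongr (by omega : 2 * (k + 1) - 1 = k + k + 1)).trans
    ((finSuccEquiv (k + k)).trans (Equiv.optionCongr finSumFinEquiv.symm))

theorem foldIndex_eq_none_iff (i : Fin (2 * (k + 1) - 1)) : foldIndex k i = none ↔ (i : ℕ) = 0 := by
  have h : foldIndex k i = none ↔ finCongr (by omega : 2 * (k + 1) - 1 = k + k + 1) i = 0 := by
    simp only [foldIndex, Equiv.trans_apply]
    rw [Equiv.optionCongr_symm, Equiv.symm_apply_eq, Equiv.optionCongr_apply, Option.map_none,
      ← finSuccEquiv_zero, EmbeddingLike.apply_eq_iff_eq]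
  rw [h, Fin.ext_iff]
  simp

/-- The quadratic coordinates of the normal form are those of index at least 1, and `none` stands
for index 0. -/
theorem sum_foldIndex {A : Type*} [AddCommMonoid A] (f : Option (Fin k ⊕ Fin k) → A) :
    ∑ i ∈ Finset.univ.filter (fun i : Fin (2 * (k + 1) - 1) => 2 ≤ (i : ℕ) + 1),
      f (foldIndex k i) = ∑ y, f (some y) := by
  have h : ∀ i : Fin (2 * (k + 1) - 1), (if 2 ≤ (i : ℕ) + 1 then f (foldIndex k i) else 0) =
      (fun o => if o = none then 0 else f o) (foldIndex k i) := by
    intro i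
    have : 2 ≤ (i : ℕ) + 1 ↔ ¬ foldIndex k i = none := by
      rw [foldIndex_eq_none_iff]; omega
    by_cases hi : foldIndex k i = none <;> simp [this, hi]
  rw [Finset.sum_filter, Finset.sum_congr rfl fun i _ => h i,
    (foldIndex k).sum_comp (fun o => if o = none then (0 : A) else f o), Fintype.sum_option]
  simp

/-- The squared modulus of the isotropic coordinate. -/
def foldRadius (δ : ℝ) (z : EuclideanSpace ℂ (Fin (k + 1 + 1))) : ℝ :=
  Complex.normSq (isotropic δ z)

/-- The last coordinates, rotated. -/
def rotated (δ : ℝ) (j : Fin k) (z : EuclideanSpace ℂ (Fin (k + 1 + 1))) : ℂ :=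
  z j.succ.succ * (starRingEnd ℂ) (isotropic δ z)

/-- The sum of the squares of the real parts of the rotated coordinates. -/
def sumReSq (δ : ℝ) (z : EuclideanSpace ℂ (Fin (k + 1 + 1))) : ℝ := ∑ j : Fin k, (rotated δ j z).re ^ 2

/-- The sum of the squares of the imaginary parts of the rotated coordinates. -/
def sumImSq (δ : ℝ) (z : EuclideanSpace ℂ (Fin (k + 1 + 1))) : ℝ := ∑ j : Fin k, (rotated δ j z).im ^ 2

/-- The sum of the products of the real and imaginary parts of the rotated coordinates. -/
def sumReIm (δ : ℝ) (z : EuclideanSpace ℂ (Fin (k + 1 + 1))) : ℝ :=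
  ∑ j : Fin k, (rotated δ j z).re * (rotated δ j z).im

/-- The coefficient of `sumReSq` in `foldRadius_mul_normSq_linearForm`. -/
def reNumerator (δ : ℝ) (z : EuclideanSpace ℂ (Fin (k + 1 + 1))) : ℝ :=
  (16 - 8 * δ) * foldRadius δ z ^ 2 - 8 * δ * (sumReSq δ z - sumImSq δ z)

/-- The coefficient of `sumImSq` in `foldRadius_mul_normSq_linearForm`. -/
def imNumerator (δ : ℝ) (z : EuclideanSpace ℂ (Fin (k + 1 + 1))) : ℝ :=
  (8 - 4 * δ) * foldRadius δ z ^ 2 - 8 * (sumReSq δ z - sumImSq δ z)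

/-- On the link, `|g|²` is a quadratic form in the rotated coordinates with variable
coefficients. -/
theorem foldRadius_mul_normSq_linearForm {δ : ℝ} (hδ : δ ^ 2 = 1) (q : link (k + 1)) :
    foldRadius δ q.1 ^ 3 * (16 * Complex.normSq (linearForm (k + 1) q) - 2 * (2 - δ) ^ 2) =
      -(reNumerator δ q.1 * sumReSq δ q.1) +
        δ * (imNumerator δ q.1 * sumImSq δ q.1 + 32 * sumReIm δ q.1 ^ 2) := by
  set P := isotropic δ q.1 with hP
  set Q := isotropic (-δ) q.1 with hQ
  have hR : foldRadius δ q.1 = P.re ^ 2 + P.im ^ 2 := by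
    rw [foldRadius, Complex.normSq_apply]; ring
  -- This is f = 0 multiplied by P̄². Its real and imaginary parts, `hσ` and `hm`, express P̄Q
  -- through the rotated coordinates.
  have hS : ∑ j : Fin k, rotated δ j q.1 ^ 2 =
      -((foldRadius δ q.1 : ℂ) * ((starRingEnd ℂ) P * Q)) := by
    have h1 := sumSquares_eq_isotropic hδ q.1
    rw [show sumSquares (k + 1) q.1 = 0 from q.2.1, ← hP, ← hQ] at h1
    have h2 : ∑ j : Fin k, rotated δ j q.1 ^ 2 =
        (starRingEnd ℂ) P ^ 2 * ∑ j : Fin k, q.1 j.succ.succ ^ 2 := by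
      rw [Finset.mul_sum]
      exact Finset.sum_congr rfl fun j _ => by rw [rotated, ← hP]; ring
    rw [h2, foldRadius, ← hP, ← Complex.mul_conj]
    linear_combination (-(starRingEnd ℂ) P ^ 2) * h1
  have hσ : sumReSq δ q.1 - sumImSq δ q.1 = -(foldRadius δ q.1 * (P.re * Q.re + P.im * Q.im)) := by
    have h := congrArg Complex.re hS
    rw [Complex.re_sum] at h
    rw [sumReSq, sumImSq, ← Finset.sum_sub_distrib]
    convert h using 1
    · exact Finset.sum_congr rfl fun j _ => by rw [sq, sq, sq, Complex.mul_re]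
    · simp
  have hm : 2 * sumReIm δ q.1 = -(foldRadius δ q.1 * (P.re * Q.im - P.im * Q.re)) := by
    have h := congrArg Complex.im hS
    rw [Complex.im_sum] at h
    rw [sumReIm, Finset.mul_sum]
    convert h using 1
    · exact Finset.sum_congr rfl fun j _ => by rw [sq, Complex.mul_im]; ring
    · simp only [Complex.neg_im, Complex.mul_im, Complex.conj_re, Complex.ofReal_re, Complex.ofReal_im,
        Complex.conj_im]
      ring
  have hT : 2 * (sumReSq δ q.1 + sumImSq δ q.1) =
      foldRadius δ q.1 * (2 - foldRadius δ q.1 - (Q.re ^ 2 + Q.im ^ 2)) := by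
    have h1 := sum_normSq_eq_one q
    rw [sum_succ_succ] at h1
    have h2 := normSq_isotropic_add hδ q.1
    rw [← hP, ← hQ, Complex.normSq_apply, Complex.normSq_apply] at h2
    have h3 : sumReSq δ q.1 + sumImSq δ q.1 = foldRadius δ q.1 *
        ∑ j : Fin k, ((q.1 j.succ.succ).re ^ 2 + (q.1 j.succ.succ).im ^ 2) := by
      rw [sumReSq, sumImSq, ← Finset.sum_add_distrib, Finset.mul_sum]
      refine Finset.sum_congr rfl fun j _ => ?_
      have := Complex.normSq_mul (q.1 j.succ.succ) ((starRingEnd ℂ) P)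
      rw [Complex.normSq_conj, Complex.normSq_apply, Complex.normSq_apply (q.1 _)] at this
      rw [rotated, foldRadius, ← hP]
      linear_combination this
    rw [h3]
    have h4 : 2 * ∑ j : Fin k, ((q.1 j.succ.succ).re ^ 2 + (q.1 j.succ.succ).im ^ 2) =
        2 - foldRadius δ q.1 - (Q.re ^ 2 + Q.im ^ 2) := by
      rw [hR]; linear_combination 2 * h1 + h2
    linear_combination foldRadius δ q.1 * h4
  have hg : 16 * Complex.normSq (linearForm (k + 1) q) = (5 + 4 * δ) * (Q.re ^ 2 + Q.im ^ 2) +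
      (5 - 4 * δ) * foldRadius δ q.1 + 6 * (P.re * Q.re + P.im * Q.im) := by
    rw [linearForm_eq_isotropic hδ, ← hP, ← hQ, Complex.normSq_div, hR, Complex.normSq_apply]
    simp only [Complex.add_re, Complex.add_im, Complex.sub_re, Complex.sub_im, Complex.mul_re,
      Complex.mul_im, Complex.ofReal_re, Complex.ofReal_im, Complex.re_ofNat, Complex.im_ofNat,
      Complex.normSq_ofNat]
    linear_combination ((Q.re ^ 2 + Q.im ^ 2) + (P.re ^ 2 + P.im ^ 2)
      - 2 * (P.re * Q.re + P.im * Q.im)) * hδ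
  have hN : (sumReSq δ q.1 - sumImSq δ q.1) ^ 2 + (2 * sumReIm δ q.1) ^ 2 =
      foldRadius δ q.1 ^ 3 * (Q.re ^ 2 + Q.im ^ 2) := by
    rw [hσ, hm, hR]; ring
  rw [hg, reNumerator, imNumerator]
  generalize foldRadius δ q.1 = R at *
  generalize sumReSq δ q.1 = x at *
  generalize sumImSq δ q.1 = y at *
  generalize sumReIm δ q.1 = m at *
  -- `hT` cancels the critical value, `hσ` removes Re(P̄Q), and `hN` turns R³|Q|² into (x - y)² +
  -- 4m². The square (x - y)² = (x - y)x - (x - y)y is shared between the coefficients of x and y;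
  -- only m² is left over.
  linear_combination (-8 * δ) * hN + (6 * R ^ 2) * hσ + ((5 - 4 * δ) * R ^ 2) * hT +
    (4 * R ^ 2 * y - 2 * R ^ 3) * hδ

/-- The factor `c` solving `2 t c + c² x = κ`, which absorbs the mixed term of the quadratic form
into the squares of the imaginary coordinates. -/
def foldCorrection (δ : ℝ) (z : EuclideanSpace ℂ (Fin (k + 1 + 1))) : ℝ :=
  32 / foldRadius δ z ^ 3 / (√(imNumerator δ z / foldRadius δ z ^ 3) +
    √(imNumerator δ z / foldRadius δ z ^ 3 + 32 / foldRadius δ z ^ 3 * sumReSq δ z))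

/-- Coordinates in which `|g|²` is a diagonal quadratic form. -/
def morseCoord (δ : ℝ) (z : EuclideanSpace ℂ (Fin (k + 1 + 1))) : Fin k ⊕ Fin k → ℝ :=
  Sum.elim (fun j => √(reNumerator δ z / foldRadius δ z ^ 3) * (rotated δ j z).re)
    (fun j => √(imNumerator δ z / foldRadius δ z ^ 3) * (rotated δ j z).im +
      foldCorrection δ z * sumReIm δ z * (rotated δ j z).re)

/-- The domain of the coordinates `morseCoord`. -/
def morseDomain (k : ℕ) (δ : ℝ) : Set (EuclideanSpace ℂ (Fin (k + 1 + 1))) :=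
  {z | 0 < foldRadius δ z ∧ 0 < reNumerator δ z ∧ 0 < imNumerator δ z}

/-- With xⱼ, yⱼ the real and imaginary parts of the rotated coordinates, the leftover term is a
multiple of m² for m = Σ xⱼyⱼ. Replacing t yⱼ by t yⱼ + c m xⱼ adds 2tc m² from the cross terms and
c² m² Σ xⱼ² from the new squares, so a suitable c absorbs it. -/
theorem normSq_linearForm_eq_sum_morseCoord {δ : ℝ} (hδ : δ ^ 2 = 1) (q : link (k + 1))
    (hq : q.1 ∈ morseDomain k δ) :
    16 * Complex.normSq (linearForm (k + 1) q) - 2 * (2 - δ) ^ 2 =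
      -∑ j : Fin k, morseCoord δ q.1 (.inl j) ^ 2 +
        δ * ∑ j : Fin k, morseCoord δ q.1 (.inr j) ^ 2 := by
  obtain ⟨hR, hA, hB⟩ := hq
  have hx : 0 ≤ sumReSq δ q.1 := Finset.sum_nonneg fun j _ => sq_nonneg _
  have key := foldRadius_mul_normSq_linearForm hδ q
  have h1 : ∑ j : Fin k, morseCoord δ q.1 (.inl j) ^ 2 =
      reNumerator δ q.1 / foldRadius δ q.1 ^ 3 * sumReSq δ q.1 := by
    simp only [morseCoord, Sum.elim_inl, mul_pow]
    rw [← Finset.mul_sum, Real.sq_sqrt (by positivity), sumReSq]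
  set t := √(imNumerator δ q.1 / foldRadius δ q.1 ^ 3) with ht
  have htpos : 0 < t := Real.sqrt_pos.2 (by positivity)
  have ht2 : t ^ 2 = imNumerator δ q.1 / foldRadius δ q.1 ^ 3 := Real.sq_sqrt (by positivity)
  set κ := 32 / foldRadius δ q.1 ^ 3 with hκ
  have hκpos : 0 < κ := by positivity
  set c := foldCorrection δ q.1 with hc
  have hc' : c = κ / (t + √(t ^ 2 + κ * sumReSq δ q.1)) := by
    rw [hc, foldCorrection, ht2]
  -- The root of the quadratic equation for c is written with the radical in the denominator, so
  -- that it stays smooth where the leading coefficient Σ xⱼ² vanishes.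
  have hquad : 2 * t * c + c ^ 2 * sumReSq δ q.1 = κ := by
    set s := √(t ^ 2 + κ * sumReSq δ q.1) with hs
    have hs2 : s ^ 2 = t ^ 2 + κ * sumReSq δ q.1 := Real.sq_sqrt (by positivity)
    have hspos : 0 ≤ s := Real.sqrt_nonneg _
    have hts : t + s ≠ 0 := by positivity
    rw [hc']
    field_simp
    linear_combination -hs2
  have h2 : ∑ j : Fin k, morseCoord δ q.1 (.inr j) ^ 2 =
      t ^ 2 * sumImSq δ q.1 + (2 * t * c + c ^ 2 * sumReSq δ q.1) * sumReIm δ q.1 ^ 2 := by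
    have e : ∀ j : Fin k, morseCoord δ q.1 (.inr j) ^ 2 = t ^ 2 * (rotated δ j q.1).im ^ 2 +
        2 * t * c * sumReIm δ q.1 * ((rotated δ j q.1).re * (rotated δ j q.1).im) +
        c ^ 2 * sumReIm δ q.1 ^ 2 * (rotated δ j q.1).re ^ 2 := fun j => by
      simp only [morseCoord, Sum.elim_inr]; ring
    rw [Finset.sum_congr rfl fun j _ => e j, Finset.sum_add_distrib, Finset.sum_add_distrib,
      ← Finset.mul_sum, ← Finset.mul_sum, ← Finset.mul_sum, ← sumReIm, ← sumImSq, ← sumReSq]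
    ring
  rw [h1, h2, hquad, ht2, hκ]
  field_simp
  linear_combination key

end FoldCoordinates
-- Charts realizing the fold normal form
section FoldCharts

variable {k : ℕ}

theorem isotropic_eq_clm (δ : ℝ) : (isotropic δ : EuclideanSpace ℂ (Fin (k + 1 + 1)) → ℂ) =
    (coordCLM 0 - (δ * Complex.I) • coordCLM 1 : EuclideanSpace ℂ (Fin (k + 1 + 1)) →L[ℝ] ℂ) := by
  ext1 z; simp [isotropic]

theorem contDiff_isotropic (δ : ℝ) :
    ContDiff ℝ ∞ (isotropic δ : EuclideanSpace ℂ (Fin (k + 1 + 1)) → ℂ) := by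
  rw [isotropic_eq_clm]; exact ContinuousLinearMap.contDiff _

theorem contDiff_rotated (δ : ℝ) (j : Fin k) : ContDiff ℝ ∞ (rotated δ j) :=
  (coordCLM j.succ.succ).contDiff.mul (Complex.conjCLE.contDiff.comp (contDiff_isotropic δ))

theorem contDiff_rotated_re (δ : ℝ) (j : Fin k) : ContDiff ℝ ∞ fun z => (rotated δ j z).re :=
  Complex.reCLM.contDiff.comp (contDiff_rotated δ j)

theorem contDiff_rotated_im (δ : ℝ) (j : Fin k) : ContDiff ℝ ∞ fun z => (rotated δ j z).im :=
  Complex.imCLM.contDiff.comp (contDiff_rotated δ j)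

theorem contDiff_foldRadius (δ : ℝ) :
    ContDiff ℝ ∞ (foldRadius δ : EuclideanSpace ℂ (Fin (k + 1 + 1)) → ℝ) := by
  have : (foldRadius δ : EuclideanSpace ℂ (Fin (k + 1 + 1)) → ℝ) =
      fun z => (isotropic δ z).re ^ 2 + (isotropic δ z).im ^ 2 := by
    ext1 z; rw [foldRadius, Complex.normSq_apply]; ring
  rw [this]
  exact ((Complex.reCLM.contDiff.comp (contDiff_isotropic δ)).pow 2).add
    ((Complex.imCLM.contDiff.comp (contDiff_isotropic δ)).pow 2)

theorem contDiff_sumReSq (δ : ℝ) :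
    ContDiff ℝ ∞ (sumReSq δ : EuclideanSpace ℂ (Fin (k + 1 + 1)) → ℝ) :=
  ContDiff.sum fun j _ => (contDiff_rotated_re δ j).pow 2

theorem contDiff_sumImSq (δ : ℝ) :
    ContDiff ℝ ∞ (sumImSq δ : EuclideanSpace ℂ (Fin (k + 1 + 1)) → ℝ) :=
  ContDiff.sum fun j _ => (contDiff_rotated_im δ j).pow 2

theorem contDiff_sumReIm (δ : ℝ) :
    ContDiff ℝ ∞ (sumReIm δ : EuclideanSpace ℂ (Fin (k + 1 + 1)) → ℝ) :=
  ContDiff.sum fun j _ => (contDiff_rotated_re δ j).mul (contDiff_rotated_im δ j)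

theorem contDiff_reNumerator (δ : ℝ) :
    ContDiff ℝ ∞ (reNumerator δ : EuclideanSpace ℂ (Fin (k + 1 + 1)) → ℝ) :=
  (contDiff_const.mul ((contDiff_foldRadius δ).pow 2)).sub
    (contDiff_const.mul ((contDiff_sumReSq δ).sub (contDiff_sumImSq δ)))

theorem contDiff_imNumerator (δ : ℝ) :
    ContDiff ℝ ∞ (imNumerator δ : EuclideanSpace ℂ (Fin (k + 1 + 1)) → ℝ) :=
  (contDiff_const.mul ((contDiff_foldRadius δ).pow 2)).sub
    (contDiff_const.mul ((contDiff_sumReSq δ).sub (contDiff_sumImSq δ)))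

theorem isOpen_morseDomain (k : ℕ) (δ : ℝ) : IsOpen (morseDomain k δ) :=
  (isOpen_lt continuous_const (contDiff_foldRadius δ).continuous).inter
    ((isOpen_lt continuous_const (contDiff_reNumerator δ).continuous).inter
      (isOpen_lt continuous_const (contDiff_imNumerator δ).continuous))

theorem contDiffOn_sqrt_reNumerator (δ : ℝ) :
    ContDiffOn ℝ ∞ (fun z => √(reNumerator δ z / foldRadius δ z ^ 3)) (morseDomain k δ) :=
  ((contDiff_reNumerator δ).contDiffOn.div ((contDiff_foldRadius δ).pow 3).contDiffOn
    fun _ hz => (pow_pos hz.1 3).ne').sqrt fun _ hz => (div_pos hz.2.1 (pow_pos hz.1 3)).ne'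

theorem contDiffOn_sqrt_imNumerator (δ : ℝ) :
    ContDiffOn ℝ ∞ (fun z => √(imNumerator δ z / foldRadius δ z ^ 3)) (morseDomain k δ) :=
  ((contDiff_imNumerator δ).contDiffOn.div ((contDiff_foldRadius δ).pow 3).contDiffOn
    fun _ hz => (pow_pos hz.1 3).ne').sqrt fun _ hz => (div_pos hz.2.2 (pow_pos hz.1 3)).ne'

theorem contDiffOn_foldCorrection (δ : ℝ) :
    ContDiffOn ℝ ∞ (foldCorrection δ) (morseDomain k δ) := by
  have hR : ContDiffOn ℝ ∞ (fun z => 32 / foldRadius δ z ^ 3) (morseDomain k δ) :=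
    contDiffOn_const.div ((contDiff_foldRadius δ).pow 3).contDiffOn
      fun _ hz => (pow_pos hz.1 3).ne'
  have hpos : ∀ z ∈ morseDomain k δ, 0 < imNumerator δ z / foldRadius δ z ^ 3 :=
    fun z hz => div_pos hz.2.2 (pow_pos hz.1 3)
  have hnonneg : ∀ z ∈ morseDomain k δ, 0 ≤ 32 / foldRadius δ z ^ 3 * sumReSq δ z := fun z hz =>
    mul_nonneg (div_nonneg (by norm_num) (pow_pos hz.1 3).le)
      (Finset.sum_nonneg fun j _ => sq_nonneg _)
  refine hR.div ((contDiffOn_sqrt_imNumerator δ).add (ContDiffOn.sqrt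
    (((contDiff_imNumerator δ).contDiffOn.div ((contDiff_foldRadius δ).pow 3).contDiffOn
      fun _ hz => (pow_pos hz.1 3).ne').add (hR.mul (contDiff_sumReSq δ).contDiffOn)) ?_)) ?_
  · exact fun z hz => (add_pos_of_pos_of_nonneg (hpos z hz) (hnonneg z hz)).ne'
  · exact fun z hz => (add_pos_of_pos_of_nonneg (Real.sqrt_pos.2 (hpos z hz))
      (Real.sqrt_nonneg _)).ne'

theorem contDiffOn_morseCoord (δ : ℝ) (y : Fin k ⊕ Fin k) :
    ContDiffOn ℝ ∞ (fun z => morseCoord δ z y) (morseDomain k δ) := by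
  rcases y with j | j
  · exact (contDiffOn_sqrt_reNumerator δ).mul (contDiff_rotated_re δ j).contDiffOn
  · exact ((contDiffOn_sqrt_imNumerator δ).mul (contDiff_rotated_im δ j).contDiffOn).add
      (((contDiffOn_foldCorrection δ).mul (contDiff_sumReIm δ).contDiffOn).mul
        (contDiff_rotated_re δ j).contDiffOn)

section AtSingularPoint

variable {δ : ℝ} {q : link (k + 1)}

theorem rotated_eq_zero (hq : q ∈ singularCircle k δ) (j : Fin k) : rotated δ j q.1 = 0 := by
  rw [rotated, hq.2 j, zero_mul]

theorem mem_morseDomain (hδ : δ ^ 2 = 1) (hq : q ∈ singularCircle k δ) :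
    q.1 ∈ morseDomain k δ := by
  have hR : foldRadius δ q.1 = 2 := normSq_isotropic_of_mem_singularCircle hδ hq
  have hx : sumReSq δ q.1 = 0 := Finset.sum_eq_zero fun j _ => by simp [rotated_eq_zero hq j]
  have hy : sumImSq δ q.1 = 0 := Finset.sum_eq_zero fun j _ => by simp [rotated_eq_zero hq j]
  refine ⟨?_, ?_, ?_⟩
  · rw [hR]; norm_num
  · rw [reNumerator, hR, hx, hy]; nlinarith
  · rw [imNumerator, hR, hx, hy]; nlinarith

theorem morseCoord_eq_zero (hq : q ∈ singularCircle k δ) (y : Fin k ⊕ Fin k) :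
    morseCoord δ q.1 y = 0 := by
  rcases y with j | j <;> simp [morseCoord, rotated_eq_zero hq j]

theorem fderiv_rotated (hq : q ∈ singularCircle k δ) (j : Fin k)
    (v : EuclideanSpace ℂ (Fin (k + 1 + 1))) :
    fderiv ℝ (rotated δ j) q.1 v = v j.succ.succ * (starRingEnd ℂ) (isotropic δ q.1) := by
  have h1 : DifferentiableAt ℝ (fun z : EuclideanSpace ℂ (Fin (k + 1 + 1)) =>
      (starRingEnd ℂ) (isotropic δ z)) q.1 :=
    (Complex.conjCLE.contDiff.comp (contDiff_isotropic δ)).differentiable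
      (n := ∞) (by simp) q.1
  have h2 := (coordCLM (n := k + 1) j.succ.succ).hasFDerivAt (x := q.1)
  have h3 := (h2.mul h1.hasFDerivAt).fderiv
  have h4 : rotated δ j = (⇑(coordCLM (n := k + 1) j.succ.succ) *
    fun z : EuclideanSpace ℂ (Fin (k + 1 + 1)) => (starRingEnd ℂ) (isotropic δ z)) := rfl
  rw [h4, h3]
  simp [hq.2 j, mul_comm]

theorem fderiv_rotated_re (hq : q ∈ singularCircle k δ) (j : Fin k)
    (v : EuclideanSpace ℂ (Fin (k + 1 + 1))) :
    fderiv ℝ (fun z => (rotated δ j z).re) q.1 v =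
      (v j.succ.succ * (starRingEnd ℂ) (isotropic δ q.1)).re := by
  rw [← fderiv_rotated hq]
  have := (Complex.reCLM.hasFDerivAt.comp q.1
    ((contDiff_rotated δ j).differentiable (by simp) q.1).hasFDerivAt).fderiv
  exact DFunLike.congr_fun this v

theorem fderiv_rotated_im (hq : q ∈ singularCircle k δ) (j : Fin k)
    (v : EuclideanSpace ℂ (Fin (k + 1 + 1))) :
    fderiv ℝ (fun z => (rotated δ j z).im) q.1 v =
      (v j.succ.succ * (starRingEnd ℂ) (isotropic δ q.1)).im := by
  rw [← fderiv_rotated hq]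
  have := (Complex.imCLM.hasFDerivAt.comp q.1
    ((contDiff_rotated δ j).differentiable (by simp) q.1).hasFDerivAt).fderiv
  exact DFunLike.congr_fun this v

/-- Every summand of `morseCoord` is a product whose last factor vanishes at the singular point, so
only the derivative of that factor survives. -/
theorem fderiv_mul_of_eq_zero {E : Type*} [NormedAddCommGroup E] [NormedSpace ℝ E] {f g : E → ℝ}
    {x : E} (hf : DifferentiableAt ℝ f x) (hg : DifferentiableAt ℝ g x) (h0 : g x = 0) (v : E) :
    fderiv ℝ (fun z => f z * g z) x v = f x * fderiv ℝ g x v := by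
  rw [fderiv_fun_mul hf hg]
  simp [h0]

theorem differentiableAt_of_contDiffOn_morseDomain (hδ : δ ^ 2 = 1) (hq : q ∈ singularCircle k δ)
    {f : EuclideanSpace ℂ (Fin (k + 1 + 1)) → ℝ} (hf : ContDiffOn ℝ ∞ f (morseDomain k δ)) :
    DifferentiableAt ℝ f q.1 :=
  (hf.contDiffAt ((isOpen_morseDomain k δ).mem_nhds (mem_morseDomain hδ hq))).differentiableAt
    (by simp)

/-- The coordinates `morseCoord` determine the last coordinates of tangent vectors. -/
theorem eq_zero_of_fderiv_morseCoord_eq_zero (hδ : δ ^ 2 = 1) (hq : q ∈ singularCircle k δ)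
    {v : EuclideanSpace ℂ (Fin (k + 1 + 1))}
    (hv : ∀ y, fderiv ℝ (fun z => morseCoord δ z y) q.1 v = 0) (j : Fin k) :
    v j.succ.succ = 0 := by
  have hdom := mem_morseDomain hδ hq
  have hre := (contDiff_rotated_re δ j).differentiable (by simp) q.1
  have him := (contDiff_rotated_im δ j).differentiable (by simp) q.1
  have hre0 : (rotated δ j q.1).re = 0 := by rw [rotated_eq_zero hq]; rfl
  have him0 : (rotated δ j q.1).im = 0 := by rw [rotated_eq_zero hq]; rfl
  have hA := differentiableAt_of_contDiffOn_morseDomain hδ hq (contDiffOn_sqrt_reNumerator δ)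
  have hB := differentiableAt_of_contDiffOn_morseDomain hδ hq (contDiffOn_sqrt_imNumerator δ)
  have hC := differentiableAt_of_contDiffOn_morseDomain hδ hq
    ((contDiffOn_foldCorrection δ).mul (contDiff_sumReIm δ).contDiffOn)
  have h1 := hv (.inl j)
  have h2 := hv (.inr j)
  simp only [morseCoord, Sum.elim_inl, Sum.elim_inr] at h1 h2
  rw [fderiv_mul_of_eq_zero hA hre hre0, mul_eq_zero] at h1
  have h1' := h1.resolve_left
    (Real.sqrt_pos.2 (div_pos hdom.2.1 (pow_pos hdom.1 3))).ne'
  -- The correction term drops out, since the derivative of the real part along `v` is already known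
  -- to vanish.
  rw [fderiv_fun_add (hB.fun_mul him) (hC.fun_mul hre), add_apply,
    fderiv_mul_of_eq_zero hB him him0, fderiv_mul_of_eq_zero hC hre hre0, h1', mul_zero, add_zero,
    mul_eq_zero] at h2
  have h2' := h2.resolve_left
    (Real.sqrt_pos.2 (div_pos hdom.2.2 (pow_pos hdom.1 3))).ne'
  rw [fderiv_rotated_re hq] at h1'
  rw [fderiv_rotated_im hq] at h2'
  have h3 : v j.succ.succ * (starRingEnd ℂ) (isotropic δ q.1) = 0 := Complex.ext h1' h2'
  refine (mul_eq_zero.1 h3).resolve_right ?_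
  simpa using isotropic_ne_zero_of_mem_singularCircle hδ hq

end AtSingularPoint

/-- Coordinates on the source in which `linkMap` has the fold normal form; `c` is the critical
value. -/
def sourceCoord (δ : ℝ) (c : ℂ) (z : EuclideanSpace ℂ (Fin (k + 1 + 1))) :
    EuclideanSpace ℝ (Fin (2 * (k + 1) - 1)) :=
  WithLp.toLp 2 fun i =>
    (foldIndex k i).elim (linearForm (k + 1) z * (starRingEnd ℂ) c).im (morseCoord δ z)

theorem sourceCoord_none (δ : ℝ) (c : ℂ) (z : EuclideanSpace ℂ (Fin (k + 1 + 1))) :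
    sourceCoord δ c z ((foldIndex k).symm none) = (linearForm (k + 1) z * (starRingEnd ℂ) c).im := by
  simp [sourceCoord]

theorem sourceCoord_some (δ : ℝ) (c : ℂ) (z : EuclideanSpace ℂ (Fin (k + 1 + 1)))
    (y : Fin k ⊕ Fin k) :
    sourceCoord δ c z ((foldIndex k).symm (some y)) = morseCoord δ z y := by
  simp [sourceCoord]

/-- The angular coordinate of `linearForm` as a linear form. -/
def angularCLM (k : ℕ) (c : ℂ) : EuclideanSpace ℂ (Fin (k + 1 + 1)) →L[ℝ] ℝ :=
  Complex.imCLM.comp ((starRingEnd ℂ) c • linearFormCLM (k + 1))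

theorem angularCLM_apply (c : ℂ) (z : EuclideanSpace ℂ (Fin (k + 1 + 1))) :
    angularCLM k c z = (linearForm (k + 1) z * (starRingEnd ℂ) c).im := by
  rw [angularCLM, ContinuousLinearMap.comp_apply, smul_apply,
    linearFormCLM_apply, smul_eq_mul, mul_comm]; rfl

theorem contDiffOn_sourceCoord (δ : ℝ) (c : ℂ) :
    ContDiffOn ℝ ∞ (sourceCoord δ c) (morseDomain k δ) := by
  rw [contDiffOn_euclidean]
  intro i
  simp only [sourceCoord]
  rcases foldIndex k i with _ | y
  · simp only [Option.elim, ← angularCLM_apply]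
    exact (angularCLM k c).contDiff.contDiffOn
  · exact contDiffOn_morseCoord δ y

/-- The Morse coordinates kill the tail of v; tangency kills Q(v) and the component of P(v) along
P(q). The angular coordinate kills the other component, because g(v) and g(q) are the same real
multiple of P(v) and P(q). -/
theorem sourceCoord_fderiv_injective {δ : ℝ} (hδ : δ ^ 2 = 1) {q : link (k + 1)}
    (hq : q ∈ singularCircle k δ) {v : EuclideanSpace ℂ (Fin (k + 1 + 1))}
    (hv : fderiv ℝ (sourceCoord δ (linearForm (k + 1) q)) q.1 v = 0)
    (hFv : fderiv ℝ (linkEquation (k + 1)) q v = 0) : v = 0 := by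
  set c := linearForm (k + 1) q with hc
  have hd : DifferentiableAt ℝ (sourceCoord δ c) q.1 :=
    ((contDiffOn_sourceCoord δ c).contDiffAt
      ((isOpen_morseDomain k δ).mem_nhds (mem_morseDomain hδ hq))).differentiableAt (by simp)
  have hcomp : ∀ i, fderiv ℝ (fun z => sourceCoord δ c z i) q.1 v = 0 := by
    intro i
    have h1 := ((EuclideanSpace.proj (𝕜 := ℝ) i).hasFDerivAt.comp q.1 hd.hasFDerivAt).fderiv
    have h2 := DFunLike.congr_fun h1 v
    rw [ContinuousLinearMap.comp_apply, hv, map_zero] at h2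
    exact h2
  have htail := eq_zero_of_fderiv_morseCoord_eq_zero hδ hq (v := v) fun y => by
    have := hcomp ((foldIndex k).symm (some y))
    simpa only [sourceCoord_some] using this
  have hang := hcomp ((foldIndex k).symm none)
  simp only [sourceCoord_none, ← angularCLM_apply] at hang
  rw [ContinuousLinearMap.fderiv, angularCLM_apply] at hang
  obtain ⟨hQ, hP⟩ := isotropic_eq_of_tangent hδ hq hFv
  have hP0 : isotropic δ v = 0 := by
    have h1 : linearForm (k + 1) v = ((2 - δ) / 4 : ℝ) * isotropic δ v := by
      rw [linearForm_eq_isotropic hδ, hQ]; push_cast; ring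
    have h2 : c = ((2 - δ) / 4 : ℝ) * isotropic δ q.1 := by
      rw [hc, linearForm_eq_isotropic hδ, hq.1]; push_cast; ring
    have h3 : ((starRingEnd ℂ) (isotropic δ q.1) * isotropic δ v).im = 0 := by
      rw [h1, h2, map_mul, Complex.conj_ofReal] at hang
      have h4 : ((2 - δ) / 4 : ℝ) * isotropic δ v *
          (((2 - δ) / 4 : ℝ) * (starRingEnd ℂ) (isotropic δ q.1)) =
          (((2 - δ) / 4 * ((2 - δ) / 4) : ℝ) : ℂ) *
            ((starRingEnd ℂ) (isotropic δ q.1) * isotropic δ v) := by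
        push_cast; ring
      rw [h4, Complex.im_ofReal_mul, mul_eq_zero] at hang
      refine hang.resolve_left ?_
      have : (2 - δ) ≠ 0 := by
        intro h0
        nlinarith
      positivity
    have h5 : (starRingEnd ℂ) (isotropic δ q.1) * isotropic δ v = 0 := Complex.ext hP h3
    refine (mul_eq_zero.1 h5).resolve_left ?_
    simpa using isotropic_ne_zero_of_mem_singularCircle hδ hq
  have h0 : v 0 = 0 := by
    have : 2 * v 0 = isotropic δ v + isotropic (-δ) v := by
      rw [isotropic, isotropic]; push_cast; ring
    rw [hP0, hQ, add_zero] at this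
    simpa using this
  have h1 : v 1 = 0 := by
    have h : (δ : ℂ) ^ 2 = 1 := by exact_mod_cast hδ
    have : 2 * v 1 = δ * Complex.I * (isotropic δ v - isotropic (-δ) v) := by
      rw [isotropic, isotropic]; push_cast
      linear_combination (-2 * v 1) * h + (2 * δ ^ 2 * v 1) * Complex.I_sq
    rw [hP0, hQ, sub_zero, mul_zero] at this
    simpa using this
  ext i
  refine Fin.cases h0 (fun i => ?_) i
  exact Fin.cases h1 (fun i => htail i) i

/-- Coordinates on the target in which `linkMap` has the fold normal form. -/
def targetCoord (δ : ℝ) (c : ℂ) (p : EuclideanSpace ℝ (Fin 2)) : EuclideanSpace ℝ (Fin 2) :=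
  !₂[p 1 * c.re - p 0 * c.im, 16 * (p 0 ^ 2 + p 1 ^ 2) - 2 * (2 - δ) ^ 2]

theorem targetCoord_planeIso (δ : ℝ) (c w : ℂ) :
    targetCoord δ c (planeIso w) =
      !₂[(w * (starRingEnd ℂ) c).im, 16 * Complex.normSq w - 2 * (2 - δ) ^ 2] := by
  rw [targetCoord, planeIso_apply, Complex.normSq_apply]
  ext i
  fin_cases i
  · simp; ring
  · simp; ring

/-- At c the two differentials are the real pairings with ic and with 32c, independent for c ≠ 0. -/
theorem exists_targetChart (δ : ℝ) {c : ℂ} (hc : c ≠ 0) :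
    ∃ e' ∈ IsManifold.maximalAtlas (𝓡 2) ∞ (EuclideanSpace ℝ (Fin 2)),
      planeIso c ∈ e'.source ∧ ⇑e' = targetCoord δ c := by
  have hsmooth : ContDiff ℝ ∞ (targetCoord δ c) := by
    rw [contDiff_euclidean]
    intro i
    fin_cases i
    · simp only [targetCoord, Fin.zero_eta, PiLp.toLp_apply, Matrix.cons_val_zero]
      fun_prop
    · simp only [targetCoord, Fin.mk_one, PiLp.toLp_apply, Matrix.cons_val_one,
        Matrix.cons_val_fin_one]
      fun_prop
  have hproj : ∀ i : Fin 2, HasFDerivAt (fun p : EuclideanSpace ℝ (Fin 2) => p i)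
      (EuclideanSpace.proj i : EuclideanSpace ℝ (Fin 2) →L[ℝ] ℝ) (planeIso c) :=
    fun i => (EuclideanSpace.proj i : EuclideanSpace ℝ (Fin 2) →L[ℝ] ℝ).hasFDerivAt
  have hcomp : ∀ i v, fderiv ℝ (targetCoord δ c) (planeIso c) v i =
      fderiv ℝ (fun p => targetCoord δ c p i) (planeIso c) v := by
    intro i v
    have h1 := ((EuclideanSpace.proj (𝕜 := ℝ) i).hasFDerivAt.comp (planeIso c)
      (hsmooth.differentiable (by simp) (planeIso c)).hasFDerivAt).fderiv
    exact (DFunLike.congr_fun h1 v).symm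
  obtain ⟨e', he', -, heq, hsymm⟩ := exists_openPartialHomeomorph_of_injective_fderiv rfl
    isOpen_univ hsmooth.contDiffOn (Set.mem_univ (planeIso c)) (fun v hv => by
      have h0 := hcomp 0 v
      have h1 := hcomp 1 v
      rw [hv] at h0 h1
      have e0 : HasFDerivAt (fun p => targetCoord δ c p 0) _ (planeIso c) :=
        ((hproj 1).mul_const c.re).sub ((hproj 0).mul_const c.im)
      have e1 : HasFDerivAt (fun p => targetCoord δ c p 1) _ (planeIso c) :=
        ((((hproj 0).pow 2).add ((hproj 1).pow 2)).const_mul 16).sub_const (2 * (2 - δ) ^ 2)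
      rw [e0.fderiv] at h0
      rw [e1.fderiv] at h1
      simp [planeIso_apply] at h0 h1
      have hn : c.re ^ 2 + c.im ^ 2 ≠ 0 := by
        have := Complex.normSq_pos.2 hc
        rw [Complex.normSq_apply] at this
        nlinarith
      have hv0 : (c.re ^ 2 + c.im ^ 2) * v 0 = 0 := by linear_combination c.im * h0 - c.re / 32 * h1
      have hv1 : (c.re ^ 2 + c.im ^ 2) * v 1 = 0 := by
        linear_combination -c.re * h0 - c.im / 32 * h1
      ext i
      fin_cases i
      · exact (mul_eq_zero.1 hv0).resolve_left hn
      · exact (mul_eq_zero.1 hv1).resolve_left hn)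
  refine ⟨e', e'.mem_maximalAtlas_of_contMDiffOn ?_ (contMDiffOn_iff_contDiffOn.2 hsymm), he', heq⟩
  rw [heq]
  exact contMDiffOn_iff_contDiffOn.2 hsmooth.contDiffOn

/-- The signs of the normal form along the singular circles. -/
def foldSigns (k : ℕ) (s : ℤˣ) (i : Fin (2 * (k + 1) - 1)) : ℤˣ :=
  (foldIndex k i).elim 1 (Sum.elim (fun _ => -1) (fun _ => s))

theorem linearForm_ne_zero {δ : ℝ} (hδ : δ ^ 2 = 1) {q : link (k + 1)}
    (hq : q ∈ singularCircle k δ) : linearForm (k + 1) q ≠ 0 := by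
  rw [linearForm_eq_isotropic hδ, hq.1, mul_zero, zero_add]
  refine div_ne_zero (mul_ne_zero ?_ (isotropic_ne_zero_of_mem_singularCircle hδ hq)) (by norm_num)
  intro h0
  have : (2 - δ : ℝ) = 0 := by exact_mod_cast h0
  nlinarith

/-- The unit `s` plays two roles: as δ it selects the circle, and it is the sign of the second group
of squares. -/
theorem IsSubmanifoldAtlas.hasFoldNormalFormAt
    {cs : ChartedSpace (EuclideanSpace ℝ (Fin (2 * (k + 1) - 1))) (link (k + 1))}
    (h : IsSubmanifoldAtlas (k + 1) cs) {s : ℤˣ} {q : link (k + 1)}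
    (hq : q ∈ singularCircle k ((s : ℤ) : ℝ)) (hpm : 2 ≤ 2 * (k + 1) - 1) :
    HasFoldNormalFormAt (2 * (k + 1) - 1) (linkMap (k + 1)) q hpm (foldSigns k s) := by
  set δ : ℝ := ((s : ℤ) : ℝ)
  have hδ : δ ^ 2 = 1 := by
    rcases Int.units_eq_one_or s with hs | hs <;> simp [δ, hs]
  set c := linearForm (k + 1) q with hc
  obtain ⟨e', he'A, he', heq'⟩ := exists_targetChart δ (linearForm_ne_zero hδ hq)
  -- Shrinking the domain makes the source chart map into the domain of the target chart.
  let U := morseDomain k δ ∩ linkMapCLM (k + 1) ⁻¹' e'.source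
  have hU : IsOpen U :=
    (isOpen_morseDomain k δ).inter (e'.open_source.preimage (linkMapCLM (k + 1)).continuous)
  have hqU : q.1 ∈ U := ⟨mem_morseDomain hδ hq, by
    rw [Set.mem_preimage, linkMapCLM_apply]; exact he'⟩
  obtain ⟨e, he, hqe, heU⟩ := exists_isSubmanifoldChart_eq finrank_linkSpace contDiff_linkEquation
    mem_link_iff hU ((contDiffOn_sourceCoord δ c).mono fun z hz => hz.1) q hqU
    (fun v => sourceCoord_fderiv_injective hδ hq)
  have hmain : ∀ x ∈ e.source, e' (linkMap (k + 1) x) = foldNormalForm hpm (foldSigns k s) (e x) := by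
    intro x hx
    obtain ⟨hxU, hex⟩ := heU x hx
    rw [heq', linkMap_eq, targetCoord_planeIso, hex]
    ext i
    fin_cases i
    · have h0 : foldIndex k (Fin.castLE hpm 0) = none := (foldIndex_eq_none_iff _).2 rfl
      simp only [foldNormalForm, sourceCoord, Fin.zero_eta, PiLp.toLp_apply, Matrix.cons_val_zero]
      rw [if_pos (by norm_num), h0]
      rfl
    · have h1 := sum_foldIndex (k := k) fun o =>
        (((o.elim 1 (Sum.elim (fun _ => -1) (fun _ => s)) : ℤˣ) : ℤ) : ℝ) *
          (o.elim (linearForm (k + 1) x * (starRingEnd ℂ) c).im (morseCoord δ x.1)) ^ 2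
      have h2 := normSq_linearForm_eq_sum_morseCoord hδ x hxU.1
      simp only [foldNormalForm, sourceCoord, foldSigns, Fin.mk_one, Fin.val_one, PiLp.toLp_apply,
        Matrix.cons_val_one, Matrix.cons_val_fin_one]
      rw [if_neg (by norm_num), h1, h2, Fintype.sum_sum_type]
      simp [Finset.mul_sum, δ]
  have hzero : e q = 0 := by
    rw [(heU q hqe).2]
    ext i
    simp only [sourceCoord, PiLp.toLp_apply]
    rcases foldIndex k i with _ | y
    · simp only [Option.elim, ← hc, Complex.mul_conj, Complex.ofReal_im]; rfl
    · exact morseCoord_eq_zero hq y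
  refine ⟨e, h.mem_maximalAtlas he, e', he'A, hqe, hzero, ?_, ?_, ?_, hmain⟩
  · rw [linkMap_eq]; exact he'
  · rw [hmain q hqe, hzero]
    ext i
    simp [foldNormalForm]
  · intro x hx
    rw [linkMap_eq, ← linkMapCLM_apply]
    exact (heU x hx).1.2

end FoldCharts
-- Absolute index, and local surjectivity as an invariant
section FoldIndex

variable {k m : ℕ} {M : Type*} [TopologicalSpace M] [ChartedSpace (EuclideanSpace ℝ (Fin m)) M]

theorem negativeSigns_foldSigns (k : ℕ) (s : ℤˣ) :
    negativeSigns 2 (foldSigns k s) = k + if s = -1 then k else 0 := by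
  have h := sum_foldIndex (k := k) fun o =>
    if (o.elim 1 (Sum.elim (fun _ => -1) (fun _ => s)) : ℤˣ) = -1 then 1 else 0
  rw [negativeSigns, ← Finset.filter_filter, Finset.card_filter]
  refine h.trans ?_
  rw [Fintype.sum_sum_type]
  by_cases hs : s = -1 <;> simp [hs]

/-- Near a definite fold, a map to the plane is not locally onto. -/
theorem IsDefiniteFold.exists_image_notMem_nhds {φ : M → EuclideanSpace ℝ (Fin 2)} {q : M}
    (h : IsDefiniteFold m φ q) : ∃ V ∈ 𝓝 q, φ '' V ∉ 𝓝 (φ q) := by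
  obtain ⟨-, -, hpm, ε, ⟨e, -, e', -, hq, -, hφq, he'q, -, hform⟩, hmin⟩ := h
  -- Absolute index zero means λ = 0 or λ = m - 1, so all quadratic terms have one common sign τ and
  -- the image lies in a half-plane.
  obtain ⟨τ, hτ, hτε⟩ : ∃ τ : ℝ, τ ^ 2 = 1 ∧
      ∀ i : Fin m, 2 ≤ (i : ℕ) + 1 → 0 ≤ τ * ((ε i : ℤ) : ℝ) := by
    have hcases : negativeSigns 2 ε = 0 ∨ m - 1 ≤ negativeSigns 2 ε := by omega
    rcases hcases with h0 | h0
    · refine ⟨1, by norm_num, fun i hi => ?_⟩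
      rw [negativeSigns, Finset.card_eq_zero, Finset.filter_eq_empty_iff] at h0
      rcases Int.units_eq_one_or (ε i) with h1 | h1
      · simp [h1]
      · exact absurd ⟨hi, h1⟩ (h0 (Finset.mem_univ i))
    · refine ⟨-1, by norm_num, fun i hi => ?_⟩
      have hsub : (Finset.univ.filter fun i : Fin m => 2 ≤ (i : ℕ) + 1 ∧ ε i = -1) ⊆
          Finset.univ.filter fun i : Fin m => 2 ≤ (i : ℕ) + 1 := by
        intro i; simp +contextual
      have hcard : (Finset.univ.filter fun i : Fin m => 2 ≤ (i : ℕ) + 1).card = m - 1 := by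
        obtain ⟨m, rfl⟩ : ∃ m', m = m' + 1 := ⟨m - 1, by omega⟩
        rw [Finset.card_filter, Fin.sum_univ_succ]
        simp
      have heq := Finset.eq_of_subset_of_card_le hsub (by rw [hcard]; exact h0)
      have hi' : i ∈ Finset.univ.filter fun i : Fin m => 2 ≤ (i : ℕ) + 1 := by simpa using hi
      rw [← heq] at hi'
      simp [(Finset.mem_filter.1 hi').2.2]
  refine ⟨e.source, e.open_source.mem_nhds hq, fun hV => ?_⟩
  have h1 : ∀ᶠ y in 𝓝 (0 : EuclideanSpace ℝ (Fin 2)), 0 ≤ τ * y 1 := by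
    have ht : (0 : EuclideanSpace ℝ (Fin 2)) ∈ e'.target := he'q ▸ e'.map_source hφq
    have hc := e'.symm.continuousAt ht
    have h0 : e'.symm 0 = φ q := by rw [← he'q, e'.left_inv hφq]
    rw [ContinuousAt, h0] at hc
    filter_upwards [hc hV, e'.open_target.mem_nhds ht] with y hy hyt
    obtain ⟨x, hx, hxy⟩ := hy
    have : y = foldNormalForm hpm ε (e x) := by
      rw [← hform x hx, hxy, e'.right_inv hyt]
    rw [this, foldNormalForm, PiLp.toLp_apply, if_neg (by norm_num), Finset.mul_sum]
    refine Finset.sum_nonneg fun i hi => ?_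
    rw [← mul_assoc]
    exact mul_nonneg (hτε i (Finset.mem_filter.1 hi).2) (sq_nonneg _)
  -- The points (0, -τt) with t > 0 tend to the origin outside that half-plane.
  have h2 : Filter.Tendsto (fun t : ℝ => EuclideanSpace.single (1 : Fin 2) (-(τ * t))) (𝓝 0)
      (𝓝 0) := by
    have : Continuous fun t : ℝ => (-(τ * t)) • EuclideanSpace.single (1 : Fin 2) (1 : ℝ) := by
      fun_prop
    convert this.tendsto 0 using 2 with t
    · ext i
      fin_cases i <;> simp
    · simp
  obtain ⟨t, ht, htpos⟩ := (((h2.eventually h1).filter_mono nhdsWithin_le_nhds).and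
    (self_mem_nhdsWithin (a := (0 : ℝ)) (s := Set.Ioi 0))).exists
  have ht' : 0 ≤ τ * -(τ * t) := by simpa using ht
  have : 0 < t := htpos
  nlinarith

/-- A map to the plane with an indefinite quadratic normal form is locally onto. -/
theorem HasFoldNormalFormAt.image_mem_nhds {φ : M → EuclideanSpace ℝ (Fin 2)} {q : M}
    {hpm : 2 ≤ m} {ε : Fin m → ℤˣ} (h : HasFoldNormalFormAt m φ q hpm ε) {i j : Fin m}
    (hi : 2 ≤ (i : ℕ) + 1) (hj : 2 ≤ (j : ℕ) + 1) (hεi : ε i = 1) (hεj : ε j = -1) {V : Set M}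
    (hV : V ∈ 𝓝 q) : φ '' V ∈ 𝓝 (φ q) := by
  obtain ⟨e, -, e', -, hq, heq, hφq, he'q, hmaps, hform⟩ := h
  have hij : i ≠ j := by
    rintro rfl
    rw [hεi] at hεj
    exact absurd hεj (by decide)
  -- A continuous section of the normal form. As `√` vanishes on negative numbers, only one of the
  -- entries at `i` and `j` is active, and it produces the second coordinate with the right sign.
  let x : EuclideanSpace ℝ (Fin 2) → EuclideanSpace ℝ (Fin m) := fun y => WithLp.toLp 2 fun l =>
    if (l : ℕ) = 0 then y 0 else if l = i then √(y 1) else if l = j then √(-y 1) else 0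
  have hx : Continuous x := by
    refine (PiLp.continuous_toLp 2 _).comp (continuous_pi fun l => ?_)
    split_ifs
    · fun_prop
    · fun_prop
    · fun_prop
    · fun_prop
  have hx0 : x 0 = 0 := by
    ext l
    simp [x]
  have hxform : ∀ y, foldNormalForm hpm ε (x y) = y := by
    intro y
    ext l
    fin_cases l
    · simp [foldNormalForm, x]
    · simp only [foldNormalForm, Fin.mk_one, Fin.val_one, PiLp.toLp_apply]
      rw [if_neg (by norm_num), Finset.sum_eq_add_of_mem i j (by simpa using hi) (by simpa using hj)
        hij]
      · have hi0 : (i : ℕ) ≠ 0 := by omega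
        have hj0 : (j : ℕ) ≠ 0 := by omega
        simp only [x, hεi, hεj, if_neg hi0, if_neg hj0, if_neg hij.symm, if_true]
        rcases le_total 0 (y 1) with hy | hy
        · rw [Real.sq_sqrt hy, Real.sqrt_eq_zero_of_nonpos (by linarith)]; simp
        · rw [Real.sqrt_eq_zero_of_nonpos hy, Real.sq_sqrt (by linarith)]; simp
      · rintro l hl ⟨hli, hlj⟩
        have hl0 : (l : ℕ) ≠ 0 := by have := (Finset.mem_filter.1 hl).2; omega
        simp [x, hl0, hli, hlj]
  have ht : (0 : EuclideanSpace ℝ (Fin m)) ∈ e.target := heq ▸ e.map_source hq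
  have hnear : ∀ᶠ y in 𝓝 (0 : EuclideanSpace ℝ (Fin 2)), e'.symm y ∈ φ '' V := by
    have h0 : e.symm (x 0) = q := by rw [hx0, ← heq, e.left_inv hq]
    have hxt : x 0 ∈ e.target := hx0.symm ▸ ht
    have hc : ContinuousAt (fun y => e.symm (x y)) 0 :=
      ContinuousAt.comp (f := x) (e.symm.continuousAt hxt) hx.continuousAt
    have hVc : V ∈ 𝓝 (e.symm (x 0)) := h0.symm ▸ hV
    filter_upwards [hc hVc, hx.continuousAt (e.open_target.mem_nhds hxt)] with y hyV hyt
    refine ⟨_, hyV, ?_⟩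
    have hs := e.map_target hyt
    have := hform _ hs
    rw [e.right_inv hyt, hxform] at this
    exact (e'.left_inv (hmaps hs)).symm.trans (congrArg e'.symm this)
  have hc := e'.continuousAt hφq
  rw [ContinuousAt, he'q] at hc
  filter_upwards [hc hnear, e'.open_source.mem_nhds hφq] with c hcV hcs
  rwa [Set.mem_preimage, Set.mem_ofPred_eq, e'.left_inv hcs] at hcV

variable {cs : ChartedSpace (EuclideanSpace ℝ (Fin (2 * (k + 1) - 1))) (link (k + 1))}

theorem IsSubmanifoldAtlas.mem_singularSet (h : IsSubmanifoldAtlas (k + 1) cs) (hk : 1 ≤ k)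
    {s : ℤˣ} {q : link (k + 1)} (hq : q ∈ singularCircle k ((s : ℤ) : ℝ)) :
    q ∈ singularSet (2 * (k + 1) - 1) (linkMap (k + 1)) := by
  rw [h.singularSet_eq hk]
  rcases Int.units_eq_one_or s with rfl | rfl
  · exact Or.inr (by simpa using hq)
  · exact Or.inl (by simpa using hq)

theorem IsSubmanifoldAtlas.isFold (h : IsSubmanifoldAtlas (k + 1) cs) (hk : 1 ≤ k)
    {s : ℤˣ} {q : link (k + 1)} (hq : q ∈ singularCircle k ((s : ℤ) : ℝ)) :
    IsFold (2 * (k + 1) - 1) (linkMap (k + 1)) q :=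
  ⟨h.mem_singularSet hk hq, by norm_num, by omega, _, h.hasFoldNormalFormAt hq _⟩

theorem IsSubmanifoldAtlas.isDefiniteFold (h : IsSubmanifoldAtlas (k + 1) cs) (hk : 1 ≤ k)
    {q : link (k + 1)} (hq : q ∈ singularCircle k (-1)) :
    IsDefiniteFold (2 * (k + 1) - 1) (linkMap (k + 1)) q := by
  have hq' : q ∈ singularCircle k (((-1 : ℤˣ) : ℤ) : ℝ) := by simpa using hq
  refine ⟨h.mem_singularSet hk hq', by norm_num, by omega, _, h.hasFoldNormalFormAt hq' _, ?_⟩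
  -- Here λ = 2k = m - p + 1, so the second entry of the minimum is zero.
  rw [negativeSigns_foldSigns, if_pos rfl]
  omega

theorem IsSubmanifoldAtlas.isFoldOfAbsIndex (h : IsSubmanifoldAtlas (k + 1) cs) (hk : 1 ≤ k)
    {q : link (k + 1)} (hq : q ∈ singularCircle k 1) :
    IsFoldOfAbsIndex (2 * (k + 1) - 1) (linkMap (k + 1)) q k := by
  have hq' : q ∈ singularCircle k (((1 : ℤˣ) : ℤ) : ℝ) := by simpa using hq
  refine ⟨h.mem_singularSet hk hq', by norm_num, by omega, _, h.hasFoldNormalFormAt hq' _, ?_⟩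
  -- Here λ = k is half of m - p + 1 = 2k.
  rw [negativeSigns_foldSigns, if_neg (by decide)]
  omega

/-- An index computed in one coordinate system does not exclude definiteness in another; being
locally onto does. Since k ≥ 1, squares of both signs are present. -/
theorem IsSubmanifoldAtlas.isIndefiniteFold (h : IsSubmanifoldAtlas (k + 1) cs) (hk : 1 ≤ k)
    {q : link (k + 1)} (hq : q ∈ singularCircle k 1) :
    IsIndefiniteFold (2 * (k + 1) - 1) (linkMap (k + 1)) q := by
  have hq' : q ∈ singularCircle k (((1 : ℤˣ) : ℤ) : ℝ) := by simpa using hq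
  refine ⟨h.isFold hk hq', fun hdef => ?_⟩
  obtain ⟨V, hV, hVn⟩ := hdef.exists_image_notMem_nhds
  have hidx : ∀ y, 2 ≤ (((foldIndex k).symm (some y) : Fin _) : ℕ) + 1 := by
    intro y
    have := (foldIndex_eq_none_iff ((foldIndex k).symm (some y))).not.1 (by simp)
    omega
  exact hVn ((h.hasFoldNormalFormAt hq' (by omega)).image_mem_nhds
    (hidx (.inr ⟨0, hk⟩)) (hidx (.inl ⟨0, hk⟩)) (by simp [foldSigns]) (by simp [foldSigns]) hV)

end FoldIndex
-- Parametrization of the circles and roundness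
section Circles

variable {k : ℕ}

theorem contMDiff_coe_euclideanSphere (n : ℕ) :
    ContMDiff (𝓡 n) 𝓘(ℝ, EuclideanSpace ℝ (Fin (n + 1))) ∞
      (Subtype.val : Metric.sphere (0 : EuclideanSpace ℝ (Fin (n + 1))) 1 →
        EuclideanSpace ℝ (Fin (n + 1))) :=
  have := Fact.mk (finrank_euclideanSpace_fin (𝕜 := ℝ) (n := n + 1))
  contMDiff_coe_sphere

theorem mfderiv_clm_comp_sphere_injective {F : Type*} [NormedAddCommGroup F] [NormedSpace ℝ F]
    {T : EuclideanSpace ℝ (Fin (1 + 1)) →L[ℝ] F} (hT : Function.Injective T)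
    (u : Metric.sphere (0 : EuclideanSpace ℝ (Fin (1 + 1))) 1) :
    Function.Injective (mfderiv (𝓡 1) 𝓘(ℝ, F)
      (T ∘ ((↑) : Metric.sphere (0 : EuclideanSpace ℝ (Fin (1 + 1))) 1 → _)) u) := by
  have := Fact.mk (finrank_euclideanSpace_fin (𝕜 := ℝ) (n := 1 + 1))
  rw [mfderiv_comp (I' := 𝓘(ℝ, EuclideanSpace ℝ (Fin (1 + 1)))) u
    T.differentiableAt.mdifferentiableAt
    ((contMDiff_coe_euclideanSphere 1).mdifferentiable (by simp) u), mfderiv_eq_fderiv,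
    ContinuousLinearMap.fderiv]
  exact hT.comp (injective_mvfderiv_subtypeVal_sphere u)

/-- The linear parametrization of a singular circle. -/
def circleCLM (k : ℕ) (δ : ℝ) :
    EuclideanSpace ℝ (Fin (1 + 1)) →L[ℝ] EuclideanSpace ℂ (Fin (k + 1 + 1)) :=
  LinearMap.toContinuousLinearMap
    { toFun := fun u => WithLp.toLp 2 (Fin.cons (√2 / 2 * planeIso.symm u)
        (Fin.cons (δ * Complex.I * (√2 / 2 * planeIso.symm u)) 0))
      map_add' := fun u v => by
        ext i
        refine Fin.cases ?_ (fun i => Fin.cases ?_ (fun i => ?_) i) i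
        · simp [mul_add]
        · simp [mul_add]
        · simp
      map_smul' := fun r u => by
        ext i
        refine Fin.cases ?_ (fun i => Fin.cases ?_ (fun i => ?_) i) i
        · simp; ring
        · simp; ring
        · simp }

theorem circleCLM_zero (δ : ℝ) (u : EuclideanSpace ℝ (Fin (1 + 1))) :
    circleCLM k δ u 0 = √2 / 2 * planeIso.symm u := rfl

theorem circleCLM_one (δ : ℝ) (u : EuclideanSpace ℝ (Fin (1 + 1))) :
    circleCLM k δ u 1 = δ * Complex.I * (√2 / 2 * planeIso.symm u) := rfl

theorem circleCLM_succ_succ (δ : ℝ) (u : EuclideanSpace ℝ (Fin (1 + 1))) (j : Fin k) :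
    circleCLM k δ u j.succ.succ = 0 := rfl

theorem sqrt_two_div_two_ne_zero : ((√2 : ℝ) / 2 : ℂ) ≠ 0 := by
  have : (√2 / 2 : ℝ) ≠ 0 := by positivity
  exact_mod_cast this

theorem circleCLM_injective (δ : ℝ) : Function.Injective (circleCLM k δ) := by
  intro u v huv
  have h := congrArg (fun z : EuclideanSpace ℂ (Fin (k + 1 + 1)) => z 0) huv
  simp only [circleCLM_zero] at h
  exact planeIso.symm.injective (mul_left_cancel₀ sqrt_two_div_two_ne_zero h)

theorem linearForm_circleCLM (δ : ℝ) (u : EuclideanSpace ℝ (Fin (1 + 1))) :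
    linearForm (k + 1) (circleCLM k δ u) = ((2 - δ) * √2 / 4 : ℝ) * planeIso.symm u := by
  rw [linearForm, circleCLM_zero, circleCLM_one]
  push_cast
  linear_combination (δ * √2 / 4 * planeIso.symm u) * Complex.I_sq

theorem circleCLM_mem_link {δ : ℝ} (hδ : δ ^ 2 = 1)
    (u : Metric.sphere (0 : EuclideanSpace ℝ (Fin (1 + 1))) 1) :
    circleCLM k δ u ∈ link (k + 1) := by
  constructor
  · have h : (δ : ℂ) ^ 2 = 1 := by exact_mod_cast hδ
    rw [sumSquares, sum_succ_succ, circleCLM_zero, circleCLM_one]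
    simp only [circleCLM_succ_succ]
    simp only [ne_eq, OfNat.ofNat_ne_zero, not_false_eq_true, zero_pow, Finset.sum_const_zero,
      add_zero]
    linear_combination (-(√2 / 2 * planeIso.symm u) ^ 2 : ℂ) * h +
      ((δ : ℂ) ^ 2 * (√2 / 2 * planeIso.symm u) ^ 2) * Complex.I_sq
  · have hu : ‖planeIso.symm u‖ = 1 := by
      rw [LinearIsometryEquiv.norm_map]; exact norm_eq_of_mem_sphere u
    have hδ' : ‖(δ : ℂ)‖ ^ 2 = 1 := by rw [Complex.norm_real, Real.norm_eq_abs, sq_abs, hδ]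
    have h2 : ‖((√2 : ℝ) : ℂ)‖ ^ 2 = 2 := by
      rw [Complex.norm_real, Real.norm_eq_abs, sq_abs, Real.sq_sqrt (by norm_num)]
    have : ‖circleCLM k δ u‖ ^ 2 = 1 := by
      rw [EuclideanSpace.norm_sq_eq, sum_succ_succ, circleCLM_zero, circleCLM_one]
      simp only [circleCLM_succ_succ, norm_mul, norm_div, hu, mul_pow, div_pow, hδ', h2,
        Complex.norm_I]
      norm_num
    rwa [pow_eq_one_iff_of_nonneg (norm_nonneg _) two_ne_zero] at this

/-- The parametrization of a singular circle. -/
def singularParam {δ : ℝ} (k : ℕ) (hδ : δ ^ 2 = 1)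
    (u : Metric.sphere (0 : EuclideanSpace ℝ (Fin (1 + 1))) 1) : link (k + 1) :=
  ⟨circleCLM k δ u, circleCLM_mem_link hδ u⟩

/-- On each circle h is a homothety; its critical values, injectivity and immersivity there are all
read off from this. -/
theorem linkMap_singularParam {δ : ℝ} (hδ : δ ^ 2 = 1)
    (u : Metric.sphere (0 : EuclideanSpace ℝ (Fin (1 + 1))) 1) :
    linkMap (k + 1) (singularParam k hδ u) = ((2 - δ) * √2 / 4) • (u : EuclideanSpace ℝ (Fin 2)) := by
  have h1 : linearForm (k + 1) (singularParam k hδ u).1 =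
      ((2 - δ) * √2 / 4) • planeIso.symm (u : EuclideanSpace ℝ (Fin 2)) := by
    rw [Complex.real_smul]; exact linearForm_circleCLM δ u
  rw [linkMap_eq, h1, map_smul, LinearIsometryEquiv.apply_symm_apply]

theorem range_singularParam {δ : ℝ} (hδ : δ ^ 2 = 1) :
    Set.range (singularParam k hδ) = singularCircle k δ := by
  have h : (δ : ℂ) ^ 2 = 1 := by exact_mod_cast hδ
  ext q
  constructor
  · rintro ⟨u, rfl⟩
    refine ⟨?_, fun j => rfl⟩
    change circleCLM k δ u 0 - ((-δ : ℝ) : ℂ) * Complex.I * circleCLM k δ u 1 = 0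
    rw [circleCLM_zero, circleCLM_one]
    push_cast
    linear_combination (-(√2 / 2 * planeIso.symm u) : ℂ) * h +
      ((δ : ℂ) ^ 2 * (√2 / 2 * planeIso.symm u)) * Complex.I_sq
  · intro hq
    have hQ : q.1 0 = -(δ * Complex.I * q.1 1) := by
      have := hq.1
      rw [isotropic] at this
      push_cast at this
      linear_combination this
    have hP : isotropic δ q.1 = 2 * q.1 0 := by
      rw [isotropic, hQ]; ring
    have hn := normSq_isotropic_of_mem_singularCircle hδ hq
    have hs : ((√2 : ℝ) : ℂ) ^ 2 = 2 := by
      have : (√2 : ℝ) ^ 2 = 2 := Real.sq_sqrt (by norm_num)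
      exact_mod_cast this
    -- On the circle P = 2q₀ and |P|² = 2, so √2 q₀ has modulus 1.
    let w : ℂ := √2 * q.1 0
    have hw : ‖w‖ = 1 := by
      rw [← pow_eq_one_iff_of_nonneg (norm_nonneg _) two_ne_zero, Complex.sq_norm,
        Complex.normSq_mul, Complex.normSq_ofReal, Real.mul_self_sqrt (by norm_num)]
      rw [hP, Complex.normSq_mul, Complex.normSq_ofNat] at hn
      linarith
    refine ⟨⟨planeIso w, ?_⟩, ?_⟩
    · rw [mem_sphere_zero_iff_norm, LinearIsometryEquiv.norm_map, hw]
    · apply Subtype.ext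
      ext i
      have hw0 : (√2 / 2 * planeIso.symm (planeIso w) : ℂ) = q.1 0 := by
        rw [LinearIsometryEquiv.symm_apply_apply]
        simp only [w]
        linear_combination (q.1 0 / 2) * hs
      refine Fin.cases hw0 (fun i => Fin.cases ?_ (fun j => ?_) i) i
      · change δ * Complex.I * (√2 / 2 * planeIso.symm (planeIso w)) = q.1 1
        rw [hw0, hQ]
        linear_combination (q.1 1) * h - (δ ^ 2 * q.1 1) * Complex.I_sq
      · exact (hq.2 j).symm

theorem singularParam_injective {δ : ℝ} (hδ : δ ^ 2 = 1) :
    Function.Injective (singularParam k hδ) := fun _ _ huv =>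
  Subtype.ext (circleCLM_injective δ (congrArg Subtype.val huv))

theorem continuous_singularParam {δ : ℝ} (hδ : δ ^ 2 = 1) : Continuous (singularParam k hδ) :=
  ((circleCLM k δ).continuous.comp continuous_subtype_val).subtype_mk _

theorem isCompact_singularCircle {δ : ℝ} (hδ : δ ^ 2 = 1) : IsCompact (singularCircle k δ) := by
  rw [← range_singularParam hδ]
  exact isCompact_range (continuous_singularParam hδ)

theorem isPreconnected_singularCircle {δ : ℝ} (hδ : δ ^ 2 = 1) :
    IsPreconnected (singularCircle k δ) := by
  have hs : IsPreconnected (Metric.sphere (0 : EuclideanSpace ℝ (Fin (1 + 1))) 1) :=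
    isPreconnected_sphere (by
      rw [← Module.finrank_eq_rank, finrank_euclideanSpace_fin]; norm_num) 0 1
  have := isPreconnected_iff_preconnectedSpace.1 hs
  rw [← range_singularParam hδ]
  exact isPreconnected_range (continuous_singularParam hδ)

theorem disjoint_singularCircle (k : ℕ) :
    Disjoint (singularCircle k (-1)) (singularCircle k 1) := by
  rw [Set.disjoint_left]
  intro q h1 h2
  refine isotropic_ne_zero_of_mem_singularCircle (by norm_num) h2 ?_
  simpa using h1.1

theorem continuous_linkMap (n : ℕ) : Continuous (linkMap n) := by
  rw [linkMap_eq_comp]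
  exact (linkMapCLM n).continuous.comp continuous_subtype_val

theorem linkMap_image_singularCircle {δ : ℝ} (hδ : δ ^ 2 = 1) :
    linkMap (k + 1) '' singularCircle k δ = Metric.sphere 0 ((2 - δ) * √2 / 4) := by
  have hr : 0 < (2 - δ) * √2 / 4 := by
    have : 0 < 2 - δ := by nlinarith
    positivity
  rw [← range_singularParam hδ, ← Set.range_comp]
  ext c
  constructor
  · rintro ⟨u, rfl⟩
    rw [Function.comp_apply, linkMap_singularParam, mem_sphere_zero_iff_norm, norm_smul,
      norm_eq_of_mem_sphere u, mul_one, Real.norm_of_nonneg hr.le]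
  · intro hc
    rw [mem_sphere_zero_iff_norm] at hc
    refine ⟨⟨((2 - δ) * √2 / 4)⁻¹ • c, ?_⟩, ?_⟩
    · rw [mem_sphere_zero_iff_norm, norm_smul, hc, norm_inv, Real.norm_of_nonneg hr.le,
        inv_mul_cancel₀ hr.ne']
    · rw [Function.comp_apply, linkMap_singularParam, smul_inv_smul₀ hr.ne']

/-- The radius of the image determines δ, and on a single circle h is a homothety. -/
theorem linkMap_injOn : Set.InjOn (linkMap (k + 1)) (singularCircle k (-1) ∪ singularCircle k 1) := by
  have h2 : (0 : ℝ) < √2 := by positivity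
  have key : ∀ {δ δ' : ℝ}, (hδ : δ ^ 2 = 1) → (hδ' : δ' ^ 2 = 1) → ∀ {q q' : link (k + 1)},
      q ∈ singularCircle k δ → q' ∈ singularCircle k δ' →
      linkMap (k + 1) q = linkMap (k + 1) q' → q = q' := by
    intro δ δ' hδ hδ' q q' hq hq' h
    have h1 : linkMap (k + 1) q ∈ Metric.sphere 0 ((2 - δ) * √2 / 4) :=
      linkMap_image_singularCircle hδ ▸ Set.mem_image_of_mem _ hq
    have h1' : linkMap (k + 1) q' ∈ Metric.sphere 0 ((2 - δ') * √2 / 4) :=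
      linkMap_image_singularCircle hδ' ▸ Set.mem_image_of_mem _ hq'
    rw [h, mem_sphere_zero_iff_norm] at h1
    rw [mem_sphere_zero_iff_norm, h1] at h1'
    have hr : (2 - δ) = 2 - δ' := mul_right_cancel₀ h2.ne' (by linarith)
    obtain rfl : δ = δ' := by linarith
    rw [← range_singularParam hδ] at hq hq'
    obtain ⟨u, rfl⟩ := hq
    obtain ⟨u', rfl⟩ := hq'
    rw [linkMap_singularParam, linkMap_singularParam] at h
    have hr' : (2 - δ) * √2 / 4 ≠ 0 := by
      have : 0 < 2 - δ := by nlinarith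
      positivity
    rw [Subtype.ext (smul_right_injective _ hr' h)]
  rintro q (hq | hq) q' (hq' | hq') h
  · exact key (by norm_num) (by norm_num) hq hq' h
  · exact key (by norm_num) (by norm_num) hq hq' h
  · exact key (by norm_num) (by norm_num) hq hq' h
  · exact key (by norm_num) (by norm_num) hq hq' h

theorem connectedComponentIn_union_eq_left {X : Type*} [TopologicalSpace X] {A B : Set X}
    (hA : IsPreconnected A) (hAc : IsClosed A) (hBc : IsClosed B) (hAB : Disjoint A B) {x : X}
    (hx : x ∈ A) : connectedComponentIn (A ∪ B) x = A := by
  refine Set.Subset.antisymm ?_ (hA.subset_connectedComponentIn hx Set.subset_union_left)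
  have hpre : IsPreconnected (connectedComponentIn (A ∪ B) x) := isPreconnected_connectedComponentIn
  rcases isPreconnected_iff_subset_of_disjoint_closed.1 hpre A B hAc hBc
    (connectedComponentIn_subset _ _) (by rw [hAB.inter_eq, Set.inter_empty]) with h | h
  · exact h
  · exact absurd (h (mem_connectedComponentIn (Or.inl hx))) (Set.disjoint_left.1 hAB hx)

variable {cs : ChartedSpace (EuclideanSpace ℝ (Fin (2 * (k + 1) - 1))) (link (k + 1))}

theorem IsSubmanifoldAtlas.contMDiff_linkMap (h : IsSubmanifoldAtlas (k + 1) cs) :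
    ContMDiff (𝓡 (2 * (k + 1) - 1)) (𝓡 2) ∞ (linkMap (k + 1)) := by
  rw [linkMap_eq_comp]
  exact (linkMapCLM (k + 1)).contDiff.contMDiff.comp h.2.contMDiff

/-- Smoothness into the link is tested after the inclusion, where the parametrization is the
restriction of a linear map to the sphere. -/
theorem IsSubmanifoldAtlas.contMDiff_singularParam (h : IsSubmanifoldAtlas (k + 1) cs) {δ : ℝ}
    (hδ : δ ^ 2 = 1) :
    ContMDiff (𝓡 1) (𝓡 (2 * (k + 1) - 1)) ∞ (singularParam k hδ) :=
  (ContMDiff.iff_comp_isImmersion h.2.isImmersion).2 ⟨continuous_singularParam hδ,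
    (circleCLM k δ).contDiff.contMDiff.comp (contMDiff_coe_euclideanSphere 1)⟩

theorem IsSubmanifoldAtlas.parametrizesSphere (h : IsSubmanifoldAtlas (k + 1) cs) {δ : ℝ}
    (hδ : δ ^ 2 = 1) :
    ParametrizesSphere (k := 1) (2 * (k + 1) - 1) (singularParam k hδ) (singularCircle k δ) := by
  have := h.1
  refine ⟨⟨isImmersion_of_injective_mfderiv (h.contMDiff_singularParam hδ) fun u => ?_, ?_⟩,
    range_singularParam hδ⟩
  · have h1 := mfderiv_clm_comp_sphere_injective (circleCLM_injective (k := k) δ) u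
    have h2 : circleCLM k δ ∘ ((↑) : Metric.sphere (0 : EuclideanSpace ℝ (Fin (1 + 1))) 1 → _) =
        Subtype.val ∘ singularParam k hδ := rfl
    rw [h2, mfderiv_comp u (h.mdifferentiableAt_val _)
      ((h.contMDiff_singularParam hδ).mdifferentiable (by simp) u)] at h1
    exact Function.Injective.of_comp (f := mfderiv (𝓡 (2 * (k + 1) - 1))
      𝓘(ℝ, EuclideanSpace ℂ (Fin (k + 1 + 1))) (Subtype.val : link (k + 1) → _) _) h1
  · exact ((continuous_singularParam hδ).isClosedEmbedding (singularParam_injective hδ)).isEmbedding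

theorem IsSubmanifoldAtlas.isImmersion_linkMap_comp (h : IsSubmanifoldAtlas (k + 1) cs) {δ : ℝ}
    (hδ : δ ^ 2 = 1) :
    Manifold.IsImmersion (𝓡 1) (𝓡 (1 + 1)) ∞ (linkMap (k + 1) ∘ singularParam k hδ) := by
  refine isImmersion_of_injective_mfderiv
    (h.contMDiff_linkMap.comp (h.contMDiff_singularParam hδ)) fun u => ?_
  have hr : (2 - δ) * √2 / 4 ≠ 0 := by
    have : 0 < 2 - δ := by nlinarith
    positivity
  let T : EuclideanSpace ℝ (Fin (1 + 1)) →L[ℝ] EuclideanSpace ℝ (Fin (1 + 1)) :=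
    ((2 - δ) * √2 / 4) • ContinuousLinearMap.id ℝ _
  have hT : Function.Injective T := fun x y hxy => smul_right_injective _ hr hxy
  have heq : linkMap (k + 1) ∘ singularParam k hδ =
      T ∘ ((↑) : Metric.sphere (0 : EuclideanSpace ℝ (Fin (1 + 1))) 1 → _) := by
    ext1 u; exact linkMap_singularParam hδ u
  rw [heq]
  exact mfderiv_clm_comp_sphere_injective hT u

theorem isotopicTo_refl {p : ℕ} (A : Set (EuclideanSpace ℝ (Fin p))) : IsotopicTo A A :=
  ⟨fun _ => id, contDiff_snd, fun _ _ => ⟨Diffeomorph.refl _ _ _, rfl⟩, rfl, Set.image_id A⟩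

theorem IsSubmanifoldAtlas.linkMap_image_singularSet (h : IsSubmanifoldAtlas (k + 1) cs)
    (hk : 1 ≤ k) :
    linkMap (k + 1) '' singularSet (2 * (k + 1) - 1) (linkMap (k + 1)) =
      Metric.sphere 0 (√2 / 4) ∪ Metric.sphere 0 (3 * √2 / 4) := by
  rw [h.singularSet_eq hk, Set.image_union, linkMap_image_singularCircle (by norm_num),
    linkMap_image_singularCircle (by norm_num), Set.union_comm]
  congr 3 <;> ring

theorem IsSubmanifoldAtlas.isRoundFoldMap (h : IsSubmanifoldAtlas (k + 1) cs) (hk : 1 ≤ k) :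
    IsRoundFoldMap (2 * (k + 1) - 1) (k := 1) (linkMap (k + 1)) := by
  have hone : (1 : ℝ) ^ 2 = 1 := by norm_num
  have hneg : (-1 : ℝ) ^ 2 = 1 := by norm_num
  have hS := h.singularSet_eq hk
  -- The critical image is itself a union of concentric circles, so the constant isotopy suffices.
  refine ⟨⟨h.contMDiff_linkMap, fun q hq => ?_⟩, fun q hq => ?_, ?_, _, ?_, isotopicTo_refl _⟩
  · rcases hS ▸ hq with hq | hq
    · exact h.isFold (s := -1) hk (by simpa using hq)
    · exact h.isFold (s := 1) hk (by simpa using hq)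
  · rcases hS ▸ hq with hq' | hq'
    · refine ⟨singularParam k hneg, ?_, h.isImmersion_linkMap_comp hneg⟩
      have := connectedComponentIn_union_eq_left (isPreconnected_singularCircle hneg)
        (isCompact_singularCircle hneg).isClosed (isCompact_singularCircle hone).isClosed
        (disjoint_singularCircle k) hq'
      rw [← hS] at this
      exact this ▸ h.parametrizesSphere hneg
    · refine ⟨singularParam k hone, ?_, h.isImmersion_linkMap_comp hone⟩
      have := connectedComponentIn_union_eq_left (isPreconnected_singularCircle hone)
        (isCompact_singularCircle hone).isClosed (isCompact_singularCircle hneg).isClosed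
        (disjoint_singularCircle k).symm hq'
      rw [Set.union_comm, ← hS] at this
      exact this ▸ h.parametrizesSphere hone
  · have hcomp : IsCompact (singularSet (2 * (k + 1) - 1) (linkMap (k + 1))) := by
      rw [hS]
      exact (isCompact_singularCircle hneg).union (isCompact_singularCircle hone)
    have := isCompact_iff_compactSpace.1 hcomp
    -- A continuous injection of a compact space into a Hausdorff space is an embedding.
    refine (Continuous.isClosedEmbedding ((continuous_linkMap (k + 1)).comp continuous_subtype_val)
      fun x y hxy => Subtype.ext (linkMap_injOn (hS ▸ x.2) (hS ▸ y.2) hxy)).isEmbedding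
  · have h2 : (0 : ℝ) < √2 := by positivity
    refine ⟨0, {√2 / 4, 3 * √2 / 4}, ?_, ?_⟩
    · rintro r (rfl | rfl)
      · exact Set.mem_Ioi.2 (by positivity)
      · exact Set.mem_Ioi.2 (by positivity)
    · rw [Set.biUnion_pair]
      exact h.linkMap_image_singularSet hk

end Circles
end

theorem theorem1 (n : ℕ) (hn : 2 ≤ n) :
    -- `K_f` is a smooth `(2n-1)`-dimensional submanifold of `ℂⁿ⁺¹`
    (∃ cs : ChartedSpace (EuclideanSpace ℝ (Fin (2 * n - 1))) (link n),
      IsSubmanifoldAtlas n cs) ∧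
    -- and, for its submanifold structure:
    ∀ cs : ChartedSpace (EuclideanSpace ℝ (Fin (2 * n - 1))) (link n),
      IsSubmanifoldAtlas n cs →
      IsRoundFoldMap (2 * n - 1) (k := 1) (linkMap n) ∧
      (∃ C₀ C₁ : Set (link n),
        singularSet (2 * n - 1) (linkMap n) = C₀ ∪ C₁ ∧ Disjoint C₀ C₁ ∧
        IsSmoothCircle (2 * n - 1) C₀ ∧ IsSmoothCircle (2 * n - 1) C₁ ∧
        (∀ q ∈ C₀, IsDefiniteFold (2 * n - 1) (linkMap n) q) ∧
        (∀ q ∈ C₁, IsIndefiniteFold (2 * n - 1) (linkMap n) q ∧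
          IsFoldOfAbsIndex (2 * n - 1) (linkMap n) q (n - 1))) ∧
      linkMap n '' singularSet (2 * n - 1) (linkMap n) =
        Metric.sphere 0 (√2 / 4) ∪ Metric.sphere 0 (3 * √2 / 4) := by
  -- There are k = n - 1 tail coordinates beyond the two that enter g, and at least one of them.
  obtain ⟨k, rfl⟩ : ∃ k, n = k + 1 := ⟨n - 1, by omega⟩
  have hk : 1 ≤ k := by omega
  refine ⟨exists_isSubmanifoldAtlas k, fun cs h => ⟨h.isRoundFoldMap hk,
    ⟨singularCircle k (-1), singularCircle k 1, h.singularSet_eq hk, disjoint_singularCircle k,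
      ⟨_, h.parametrizesSphere (by norm_num)⟩, ⟨_, h.parametrizesSphere (by norm_num)⟩,
      fun q hq => h.isDefiniteFold hk hq,
      fun q hq => ⟨h.isIndefiniteFold hk hq, h.isFoldOfAbsIndex hk hq⟩⟩,
    h.linkMap_image_singularSet hk⟩⟩
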